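/- Let $\mathbb{K}$ be a principal ideal domain, let $A$ be a finitely generated torsion $\mathbb{K}$-module, and let $\Phi:\mathsf{Mod}(\mathbb{K})\to\mathsf{Mod}(\mathbb{K})$ be a (not necessarily additive) functor which takes finitely generated free modules to finitely generated free modules. Write $B^\vee=\mathrm{Hom}_{\mathbb{K}}(B,\mathbb{K})$ and $B^\diamond=\mathrm{Ext}^1_{\mathbb{K}}(B,\mathbb{K})$ for a $\mathbb{K}$-module $B$, and let $\Phi^\#(B)=\Phi(B^\vee)^\vee$ be the Kuhn dual functor of $\Phi$. Let $\mathsf{Pres}(A)$ be the full subcategory of the comma category $\mathsf{Mod}(\mathbb{K})\downarrow A$ on the epimorphisms $p:F\twoheadrightarrow A$ with $F$ free, let $\mathsf{R}_A:\mathsf{Pres}(A)\to\mathsf{Mod}(\mathbb{K})$, $\mathsf{R}_A(p)=\mathrm{Ker}(p)$, be the relation functor, and let $\lim^i\Phi\mathsf{R}_A$ be the $i$-th derived limit of the composite $\Phi\mathsf{R}_A:\mathsf{Pres}(A)\to\mathsf{Mod}(\mathbb{K})$, that is, the value at $\Phi\mathsf{R}_A$ of the $i$-th right derived functor of the limit functor.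 For a functor $\Psi:\mathsf{Mod}(\mathbb{K})\to\mathsf{Mod}(\mathbb{K})$ let $L_i\Psi(B,0)=\pi_i\big(\Psi(\mathsf{DK}_\bullet(P_\bullet))\big)$ be its derived functors in the sense of Dold--Puppe, where $P_\bullet\to B$ is a projective resolution and $\mathsf{DK}_\bullet(P_\bullet)$ is the simplicial module corresponding to $P_\bullet$ under the Dold--Kan correspondence; $L_i\Psi(B,0)=0$ for $i<0$. Then for each $i\ge 0$ there is a short exact sequence of $\mathbb{K}$-modules $$0 \to \big(L_{i-1}\Phi^\#(A^\diamond,0)\big)^\diamond \to \textstyle\lim^i\Phi\mathsf{R}_A \to \big(L_i\Phi^\#(A^\diamond,0)\big)^\vee \to 0 .$$ -/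

import Mathlib

open CategoryTheory CategoryTheory.Limits

universe w v u

noncomputable section

namespace RelationLimits

/-! ### Enough injectives in functor categories, so that right derived functors exist -/

section EnoughInjectives

/-- A functor category has enough injectives if its target has, and has the needed products:
`F` embeds into the product over all `j` of the functors coinduced from injective hulls
of `F.obj j`. -/
theorem enoughInjectives_functor {J : Type w} [Category.{v} J] {D : Type*} [Category* D]
    [Abelian D] [HasProductsOfShape J D] [∀ a b : J, HasProductsOfShape (a ⟶ b) D]
    [EnoughInjectives D] : EnoughInjectives (J ⥤ D) where
  presentation F := by
    let I : J → (J ⥤ D) := fun j => (evaluationRightAdjoint D j).obj (Injective.under (F.obj j))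
    have hI : ∀ j, Injective (I j) := fun j =>
      Injective.injective_of_adjoint (evaluationAdjunctionLeft D j) _
    let g : ∀ j, F ⟶ I j := fun j =>
      (evaluationAdjunctionLeft D j).homEquiv F _ (Injective.ι (F.obj j))
    have hg : Mono (Pi.lift g) := by
      refine (NatTrans.mono_iff_mono_app _).2 fun j => ?_
      have h : (Pi.lift g).app j ≫ (Pi.π I j).app j ≫
          (evaluationAdjunctionLeft D j).counit.app (Injective.under (F.obj j)) =
            Injective.ι (F.obj j) := by
        rw [← Category.assoc, ← NatTrans.comp_app, Pi.lift_π]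
        have := (evaluationAdjunctionLeft D j).homEquiv_counit (X := F)
          (Y := Injective.under (F.obj j)) (g := g j)
        exact this.symm.trans (((evaluationAdjunctionLeft D j).homEquiv F _).symm_apply_apply _)
      have h' : Mono ((Pi.lift g).app j ≫ (Pi.π I j).app j ≫
          (evaluationAdjunctionLeft D j).counit.app (Injective.under (F.obj j))) := by
        rw [h]; infer_instance
      exact mono_of_mono _ ((Pi.π I j).app j ≫
          (evaluationAdjunctionLeft D j).counit.app (Injective.under (F.obj j)))
    exact ⟨{ J := ∏ᶜ I, f := Pi.lift g }⟩

end EnoughInjectives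

variable {K : Type u} [CommRing K]

instance hasLimitsOfShape_modules (J : Type (u + 1)) [Category.{u} J] :
    HasLimitsOfShape J (ModuleCat.{u + 1} K) :=
  ModuleCat.hasLimitsOfShape

instance enoughInjectives_diagrams (J : Type (u + 1)) [Category.{u} J] :
    EnoughInjectives (J ⥤ ModuleCat.{u + 1} K) :=
  have : ∀ T : Type (u + 1), HasProductsOfShape T (ModuleCat.{u + 1} K) :=
    fun _ => ModuleCat.hasLimitsOfShape
  have : ∀ T : Type u, HasProductsOfShape T (ModuleCat.{u + 1} K) :=
    fun _ => ModuleCat.hasLimitsOfShape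
  enoughInjectives_functor

instance lim_additive (J : Type (u + 1)) [Category.{u} J] :
    (lim : (J ⥤ ModuleCat.{u + 1} K) ⥤ ModuleCat.{u + 1} K).Additive where
  map_add {F G f g} := limit.hom_ext fun j => by
    simp [Preadditive.add_comp, Preadditive.comp_add]

/-! ### Higher limits -/

/-- The higher limit `limⁱ F` of a functor `F : J ⥤ Mod(K)` on a (possibly large, locally small)
category: the value at `F` of the `i`-th right derived functor of `lim`. As `J` has a proper class
of objects relative to the universe of the modules, limits are taken in modules one universe up. -/
def higherLim {J : Type (u + 1)} [Category.{u} J] (i : ℕ) (F : J ⥤ ModuleCat.{u} K) :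
    ModuleCat.{u + 1} K :=
  ((lim : (J ⥤ ModuleCat.{u + 1} K) ⥤ ModuleCat.{u + 1} K).rightDerived i).obj
    (F ⋙ ModuleCat.uliftFunctor.{u + 1, u} K)

/-! ### Presentations and relations -/

/-- The category of free presentations of `A`: the full subcategory of `Mod(K) ↓ A` on the
epimorphisms `F ↠ A` with `F` free. -/
abbrev Pres (A : ModuleCat.{u} K) : Type (u + 1) :=
  ObjectProperty.FullSubcategory (C := Over A)
    fun p => Module.Free K p.left ∧ Function.Surjective p.hom

/-- The relation functor, `(p : F ↠ A) ↦ Ker p`. -/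
def relationFunctor (A : ModuleCat.{u} K) : Pres A ⥤ ModuleCat.{u} K where
  obj p := ModuleCat.of K (LinearMap.ker p.obj.hom.hom)
  map {p q} f := ModuleCat.ofHom (f.hom.left.hom.restrict fun x hx => by
    have h := congrArg (fun g => g.hom x) (Over.w f.hom)
    simp only [LinearMap.mem_ker] at hx ⊢
    exact h.trans hx)

/-! ### Duality -/

variable (K) in
/-- The contravariant functor `A ↦ A^∨ = Hom(A, K)`. -/
def dualFunctor : (ModuleCat.{u} K)ᵒᵖ ⥤ ModuleCat.{u} K where
  obj A := ModuleCat.of K (Module.Dual K A.unop)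
  map f := ModuleCat.ofHom f.unop.hom.dualMap

/-- The Kuhn dual functor `Φ^#`, with `Φ^#(A) = Φ(A^∨)^∨`. -/
def kuhnDual (Φ : ModuleCat.{u} K ⥤ ModuleCat.{u} K) : ModuleCat.{u} K ⥤ ModuleCat.{u} K :=
  (dualFunctor K).rightOp ⋙ Φ.op ⋙ dualFunctor K

/-- `A^◇ = Ext¹(A, K)`. -/
def diamond (A : ModuleCat.{u} K) : ModuleCat.{u} K :=
  ModuleCat.of K (Abelian.Ext.{u} A (ModuleCat.of K K) 1)

/-! ### Derived functors of non-additive functors -/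

/-- The homotopy groups of a simplicial module: the homology of the complex with the alternating
sums of the face maps as differentials. -/
def homotopyModule (V : SimplicialObject (ModuleCat.{u} K)) (i : ℕ) : ModuleCat.{u} K :=
  ((AlgebraicTopology.alternatingFaceMapComplex _).obj V).homology i

/-- The Dold–Puppe derived functors `L_i Ψ(B, 0)`: apply `Ψ` degreewise to the simplicial module
which corresponds under Dold–Kan to a projective resolution of `B`, and take `π_i`.
They vanish for `i < 0`. -/
def doldPuppe (Ψ : ModuleCat.{u} K ⥤ ModuleCat.{u} K) (B : ModuleCat.{u} K) :
    ℤ → ModuleCat.{u} K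
  | Int.ofNat i => homotopyModule (((SimplicialObject.whiskering _ _).obj Ψ).obj
      (Abelian.DoldKan.Γ.obj (projectiveResolution B).complex)) i
  | Int.negSucc _ => ModuleCat.of K PUnit

end RelationLimits

end

/-! The derived limits over `Pres A` are computed by an explicit cochain complex, which is the dual
of a complex computing the derived functors of `Φ^#`; the sequence is then that of universal
coefficients.

Choose a surjection `p : F → A` with `F` free of finite rank. Since free modules are projective, `p`
maps to every object of `Pres A`, and its `n + 1`-fold copower is the direct sum `Fⁿ⁺¹ → A`. For any
category with such an object, `limⁱ` of a diagram is the cohomology of the diagram's cosimplicial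
module of values on the copowers (`nonempty_rightDerived_lim_iso`): degree `0` gives the limit, the
construction is exact, and injective diagrams have no higher cohomology. So with `Rₙ = Ker(Fⁿ⁺¹ →
A)`, the complex `Φ(R_•)` computes `limⁱ Φ R_A`, and presentations of infinite rank play no further
role.

Over a principal ideal domain `Rₙ` is free of finite rank, hence so is `Φ(Rₙ)`, and biduality gives
`Φ(Rₙ) ≅ Φ^#(Rₙ^∨)^∨` (`toDualKuhnDual_bijective`). Thus `Φ(R_•)` is the dual of the complex of
finite free modules `Φ^#(R_•^∨)`, and `exists_universalCoefficients` applies.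

It remains to identify the homotopy of `Φ^#(R_•^∨)`. As `A` is torsion, dualizing the presentations
gives exact sequences `0 → (Fⁿ⁺¹)^∨ → Rₙ^∨ → A^◇ → 0`. The simplicial module on the left is
contractible, so `R_•^∨` is a simplicial projective resolution of `A^◇`
(`quasiIso_dualRelationsToDiamond`). Any such resolution computes the Dold–Puppe functors
(`nonempty_homology_iso_of_simplicialResolution`): chain homotopies of normalized complexes come
from simplicial homotopies, which every functor preserves, additive or not. -/

noncomputable section

namespace RelationLimits

open AlgebraicTopology Simplicial

/-! ### Copowers of a weakly initial object -/

section Copowers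

variable {J : Type w} [Category.{v} J]

/-- A cosimplicial object whose `n`-th term is, through its vertex maps, the coproduct of `n + 1`
copies of its `0`-th term, where the latter maps to every object. -/
structure IsCopowerSystem (X : SimplexCategory ⥤ J) : Prop where
  nonempty (j : J) : Nonempty (X.obj ⦋0⦌ ⟶ j)
  bijective (n : SimplexCategory) (j : J) : Function.Bijective
    (fun (m : X.obj n ⟶ j) (k : Fin (n.len + 1)) => X.map (SimplexCategory.const ⦋0⦌ n k) ≫ m)

namespace IsCopowerSystem

variable {X : SimplexCategory ⥤ J} (hX : IsCopowerSystem X)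

/-- The map out of a copower given by its restrictions to the vertices. -/
def desc (n : SimplexCategory) {j : J} (g : Fin (n.len + 1) → (X.obj ⦋0⦌ ⟶ j)) : X.obj n ⟶ j :=
  ((hX.bijective n j).2 g).choose

lemma vertex_desc (n : SimplexCategory) {j : J} (g : Fin (n.len + 1) → (X.obj ⦋0⦌ ⟶ j))
    (k : Fin (n.len + 1)) : X.map (SimplexCategory.const ⦋0⦌ n k) ≫ hX.desc n g = g k :=
  congrFun ((hX.bijective n j).2 g).choose_spec k

include hX in
lemma hom_ext {n : SimplexCategory} {j : J} {f g : X.obj n ⟶ j}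
    (h : ∀ k, X.map (SimplexCategory.const ⦋0⦌ n k) ≫ f =
      X.map (SimplexCategory.const ⦋0⦌ n k) ≫ g) : f = g :=
  (hX.bijective n j).1 (funext h)

/-- The map out of the `n + 2`-fold copower which is `s` on the first vertex and `f` on the
others. -/
def cons {n : ℕ} {j : J} (s : X.obj ⦋0⦌ ⟶ j) (f : X.obj ⦋n⦌ ⟶ j) : X.obj ⦋n + 1⦌ ⟶ j :=
  hX.desc ⦋n + 1⦌ (Fin.cons (α := fun _ => X.obj ⦋0⦌ ⟶ j) s
    fun k : Fin (n + 1) => X.map (SimplexCategory.const ⦋0⦌ ⦋n⦌ k) ≫ f)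

lemma vertex_map {n m : SimplexCategory} (φ : n ⟶ m) {j : J} (f : X.obj m ⟶ j)
    (k : Fin (n.len + 1)) : X.map (SimplexCategory.const ⦋0⦌ n k) ≫ X.map φ ≫ f =
      X.map (SimplexCategory.const ⦋0⦌ m (φ.toOrderHom k)) ≫ f := by
  rw [← Category.assoc, ← X.map_comp, SimplexCategory.const_comp]

lemma vertex_zero_cons {n : ℕ} {j : J} (s : X.obj ⦋0⦌ ⟶ j) (f : X.obj ⦋n⦌ ⟶ j) :
    X.map (SimplexCategory.const ⦋0⦌ ⦋n + 1⦌ 0) ≫ hX.cons s f = s :=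
  hX.vertex_desc ⦋n + 1⦌ _ 0

lemma vertex_succ_cons {n : ℕ} {j : J} (s : X.obj ⦋0⦌ ⟶ j) (f : X.obj ⦋n⦌ ⟶ j)
    (k : Fin (n + 1)) : X.map (SimplexCategory.const ⦋0⦌ ⦋n + 1⦌ k.succ) ≫ hX.cons s f =
      X.map (SimplexCategory.const ⦋0⦌ ⦋n⦌ k) ≫ f :=
  hX.vertex_desc ⦋n + 1⦌ _ k.succ

/-- Together with `δ_succ_cons`: for fixed `s`, prefixing the vertex `s` is an extra degeneracy of
the simplicial set `Hom(X_•, j)`. -/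
lemma δ_zero_cons {n : ℕ} {j : J} (s : X.obj ⦋0⦌ ⟶ j) (f : X.obj ⦋n⦌ ⟶ j) :
    X.map (SimplexCategory.δ 0) ≫ hX.cons s f = f := by
  refine hX.hom_ext fun k => ?_
  rw [vertex_map]
  exact hX.vertex_succ_cons s f k

lemma δ_succ_cons {n : ℕ} {j : J} (s : X.obj ⦋0⦌ ⟶ j) (f : X.obj ⦋n + 1⦌ ⟶ j) (i : Fin (n + 2)) :
    X.map (SimplexCategory.δ i.succ) ≫ hX.cons s f = hX.cons s (X.map (SimplexCategory.δ i) ≫ f) := by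
  refine hX.hom_ext fun k => ?_
  rw [vertex_map]
  induction k using Fin.cases with
  | zero => rw [vertex_zero_cons]; exact hX.vertex_zero_cons s f
  | succ k =>
    rw [vertex_succ_cons, vertex_map]
    refine Eq.trans ?_ (hX.vertex_succ_cons s f (i.succAbove k))
    congr 3
    exact Fin.succ_succAbove_succ i k

end IsCopowerSystem

end Copowers

/-! ### The cobar complex and its vanishing on injective diagrams -/

section Cobar

variable {K : Type u} [CommRing K] {J : Type (u + 1)} [Category.{u} J]

variable (K) in
/-- The functor which takes a diagram to the cochain complex of its values on a cosimplicial
object. -/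
def cobar (X : SimplexCategory ⥤ J) :
    (J ⥤ ModuleCat.{u + 1} K) ⥤ CochainComplex (ModuleCat.{u + 1} K) ℕ :=
  (Functor.whiskeringLeft _ _ _).obj X ⋙ alternatingCofaceMapComplex _

lemma cobar_d (X : SimplexCategory ⥤ J) (F : J ⥤ ModuleCat.{u + 1} K) (n : ℕ) :
    ((cobar K X).obj F).d n (n + 1) = ∑ i : Fin (n + 2), (-1 : ℤ) ^ (i : ℕ) • F.map (X.map (SimplexCategory.δ i)) :=
  CochainComplex.of_d (fun n => F.obj (X.obj ⦋n⦌)) (AlternatingCofaceMapComplex.objD (X ⋙ F)) n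

instance hasLimits_modules : HasLimits (ModuleCat.{u + 1} K) := ModuleCat.hasLimits.{u + 1}

instance (X : SimplexCategory ⥤ J) : (cobar K X).Additive where
  map_add := by intros; ext; rfl

/-- Exactness of diagrams is tested objectwise. The resulting long exact sequences drive the
dimension shifting below. -/
lemma cobar_shortExact (X : SimplexCategory ⥤ J) (S : ShortComplex (J ⥤ ModuleCat.{u + 1} K))
    (hS : S.ShortExact) : (S.map (cobar K X)).ShortExact :=
  HomologicalComplex.shortExact_of_degreewise_shortExact _ fun n =>
    hS.map_of_exact ((evaluation J (ModuleCat.{u + 1} K)).obj (X.obj ⦋n⦌))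

/-- The product over all `a` of the functors coinduced from the values `F.obj a`. -/
def coinduced (F : J ⥤ ModuleCat.{u + 1} K) : J ⥤ ModuleCat.{u + 1} K where
  obj x := ModuleCat.of K (∀ a : J, (x ⟶ a) → F.obj a)
  map φ := ModuleCat.ofHom
    { toFun := fun z a f => z a (φ ≫ f)
      map_add' := fun _ _ => rfl
      map_smul' := fun _ _ => rfl }

/-- The unit `F ⟶ coinduced F`. -/
def toCoinduced (F : J ⥤ ModuleCat.{u + 1} K) : F ⟶ coinduced F where
  app x := ModuleCat.ofHom
    { toFun := fun z _ f => F.map f z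
      map_add' := fun _ _ => by ext; simp
      map_smul' := fun _ _ => by ext; simp }
  naturality x y φ := by
    ext z
    funext a f
    change F.map f (F.map φ z) = F.map (φ ≫ f) z
    simp

instance (F : J ⥤ ModuleCat.{u + 1} K) : Mono (toCoinduced F) := by
  refine (NatTrans.mono_iff_mono_app _).2 fun x => (ModuleCat.mono_iff_injective _).2 ?_
  intro z w h
  have h' : F.map (𝟙 x) z = F.map (𝟙 x) w := congrFun (congrFun h x) (𝟙 x)
  simpa using h'

/-- The contraction of the cobar complex of a coinduced functor. -/
def coinducedContraction {X : SimplexCategory ⥤ J} (hX : IsCopowerSystem X)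
    (F : J ⥤ ModuleCat.{u + 1} K) (n : ℕ) :
    (coinduced F).obj (X.obj ⦋n + 1⦌) ⟶ (coinduced F).obj (X.obj ⦋n⦌) :=
  ModuleCat.ofHom
    { toFun := fun z a f => z a (hX.cons (hX.nonempty a).some f)
      map_add' := fun _ _ => rfl
      map_smul' := fun _ _ => rfl }

lemma map_δ_zero_coinducedContraction {X : SimplexCategory ⥤ J} (hX : IsCopowerSystem X)
    (F : J ⥤ ModuleCat.{u + 1} K) (n : ℕ) :
    (coinduced F).map (X.map (SimplexCategory.δ (n := n) 0)) ≫ coinducedContraction hX F n = 𝟙 _ := by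
  ext z
  funext a f
  change z a (X.map (SimplexCategory.δ 0) ≫ hX.cons _ f) = z a f
  rw [hX.δ_zero_cons]

lemma map_δ_succ_coinducedContraction {X : SimplexCategory ⥤ J} (hX : IsCopowerSystem X)
    (F : J ⥤ ModuleCat.{u + 1} K) (n : ℕ) (i : Fin (n + 2)) :
    (coinduced F).map (X.map (SimplexCategory.δ i.succ)) ≫ coinducedContraction hX F (n + 1) =
      coinducedContraction hX F n ≫ (coinduced F).map (X.map (SimplexCategory.δ i)) := by
  ext z
  funext a f
  change z a (X.map (SimplexCategory.δ i.succ) ≫ hX.cons _ f) = z a (hX.cons _ (X.map (SimplexCategory.δ i) ≫ f))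
  rw [hX.δ_succ_cons]

/-- The face `δ 0` contributes the identity; the face `δ i.succ` passes through the contraction as
`δ i`, with its sign reversed by the shift of index. -/
lemma cobar_coinduced_contraction {X : SimplexCategory ⥤ J} (hX : IsCopowerSystem X)
    (F : J ⥤ ModuleCat.{u + 1} K) (n : ℕ) :
    (∑ i : Fin (n + 3), (-1 : ℤ) ^ (i : ℕ) • (coinduced F).map (X.map (SimplexCategory.δ i))) ≫
      coinducedContraction hX F (n + 1) = 𝟙 _ - coinducedContraction hX F n ≫
        ∑ i : Fin (n + 2), (-1 : ℤ) ^ (i : ℕ) • (coinduced F).map (X.map (SimplexCategory.δ i)) := by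
  rw [Fin.sum_univ_succ, Preadditive.add_comp, Preadditive.sum_comp,
    Preadditive.comp_sum, sub_eq_add_neg, ← Finset.sum_neg_distrib]
  congr 1
  · simpa using map_δ_zero_coinducedContraction hX F (n + 1)
  · refine Finset.sum_congr rfl fun i _ => ?_
    rw [Preadditive.zsmul_comp, Preadditive.comp_zsmul, map_δ_succ_coinducedContraction,
      Fin.val_succ, pow_succ, mul_neg_one, neg_smul]

/-- A retract of a cochain complex with a contraction in positive degrees is exact there. -/
lemma exactAt_of_retract_of_contraction {C : Type*} [Category* C] [Abelian C]
    {L M : CochainComplex C ℕ} (ι : L ⟶ M) (ρ : M ⟶ L) (hιρ : ι ≫ ρ = 𝟙 L) (n : ℕ)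
    (h : M.X (n + 1) ⟶ M.X n) (h' : M.X (n + 2) ⟶ M.X (n + 1))
    (hh : M.d (n + 1) (n + 2) ≫ h' = 𝟙 _ - h ≫ M.d n (n + 1)) : L.ExactAt (n + 1) := by
  rw [HomologicalComplex.exactAt_iff' _ n (n + 1) (n + 2) (by simp) (by simp),
    ShortComplex.exact_iff_exact_up_to_refinements]
  intro A z hz
  replace hz : z ≫ L.d (n + 1) (n + 2) = 0 := hz
  have h1 : h ≫ M.d n (n + 1) = 𝟙 _ - M.d (n + 1) (n + 2) ≫ h' := by rw [hh]; abel
  have h2 : ι.f (n + 1) ≫ ρ.f (n + 1) = 𝟙 _ := by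
    rw [← HomologicalComplex.comp_f, hιρ, HomologicalComplex.id_f]
  have key : ∀ z : A ⟶ L.X (n + 1), z ≫ L.d (n + 1) (n + 2) = 0 →
      z = (z ≫ ι.f (n + 1) ≫ h ≫ ρ.f n) ≫ L.d n (n + 1) := fun z hz => by
    simp only [Category.assoc, ρ.comm, reassoc_of% h1, Preadditive.sub_comp, Category.id_comp,
      Preadditive.comp_sub, h2, Category.comp_id, ι.comm_assoc, reassoc_of% hz, zero_comp, sub_zero]
  exact ⟨A, 𝟙 A, inferInstance, _, (Category.id_comp z).trans (key z hz)⟩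

/-- An injective `I` is a retract of `coinduced I`, whose cobar complex is a product of complexes of
functions on the contractible simplicial sets `Hom(X_•, a)`. -/
lemma cobar_exactAt_of_injective {X : SimplexCategory ⥤ J} (hX : IsCopowerSystem X)
    (I : J ⥤ ModuleCat.{u + 1} K) [Injective I] (n : ℕ) :
    ((cobar K X).obj I).ExactAt (n + 1) := by
  have hr : toCoinduced I ≫ Injective.factorThru (𝟙 I) (toCoinduced I) = 𝟙 I :=
    Injective.comp_factorThru _ _
  refine exactAt_of_retract_of_contraction ((cobar K X).map (toCoinduced I))
    ((cobar K X).map (Injective.factorThru (𝟙 I) (toCoinduced I)))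
    (by rw [← Functor.map_comp, hr, CategoryTheory.Functor.map_id]) n
    (coinducedContraction hX I n) (coinducedContraction hX I (n + 1)) ?_
  rw [cobar_d, cobar_d]
  exact cobar_coinduced_contraction hX I n

end Cobar

end RelationLimits

end

noncomputable section

namespace RelationLimits

open AlgebraicTopology Simplicial

/-! ### The limit as the degree zero cohomology of the cobar complex -/

section LimCobar

variable {K : Type u} [CommRing K] {J : Type (u + 1)} [Category.{u} J]
  {X : SimplexCategory ⥤ J} (hX : IsCopowerSystem X)

lemma comp_cobar_d_zero {F : J ⥤ ModuleCat.{u + 1} K} {M : ModuleCat.{u + 1} K}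
    (g : M ⟶ F.obj (X.obj ⦋0⦌)) : g ≫ ((cobar K X).obj F).d 0 1 =
      g ≫ F.map (X.map (SimplexCategory.δ 0)) - g ≫ F.map (X.map (SimplexCategory.δ 1)) := by
  have h : ∑ i : Fin 2, (-1 : ℤ) ^ (i : ℕ) • F.map (X.map (SimplexCategory.δ i)) =
      F.map (X.map (SimplexCategory.δ 0)) - F.map (X.map (SimplexCategory.δ 1)) := by
    simp [Fin.sum_univ_two, sub_eq_add_neg]
  rw [cobar_d, ← Preadditive.comp_sub]
  exact congrArg (g ≫ ·) h

-- Two maps `a`, `b` out of the bottom term are the two restrictions of a single map out of the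
-- twofold copower, so a cocycle cannot tell them apart.
include hX in
lemma comp_map_eq_of_comp_cobar_d_eq_zero {F : J ⥤ ModuleCat.{u + 1} K} {M : ModuleCat.{u + 1} K}
    (g : M ⟶ F.obj (X.obj ⦋0⦌)) (hg : g ≫ ((cobar K X).obj F).d 0 1 = 0) {j : J}
    (a b : X.obj ⦋0⦌ ⟶ j) : g ≫ F.map a = g ≫ F.map b := by
  have h0 : X.map (SimplexCategory.δ 0) ≫ hX.cons a b = b := hX.δ_zero_cons a b
  have h1 : X.map (SimplexCategory.δ 1) ≫ hX.cons a b = a := by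
    rw [SimplexCategory.δ_one_eq_const]
    exact hX.vertex_zero_cons a b
  have h2 := (comp_cobar_d_zero g).symm.trans hg
  have h3 := congrArg (· ≫ F.map (hX.cons a b)) (sub_eq_zero.1 h2)
  simp only [Category.assoc, ← Functor.map_comp, h0, h1] at h3
  exact h3.symm

/-- The map from the limit of a diagram to the bottom term of its cobar complex. -/
def limitToCobar (X : SimplexCategory ⥤ J) (F : J ⥤ ModuleCat.{u + 1} K) :
    limit F ⟶ ((cobar K X).obj F).X 0 :=
  limit.π F (X.obj ⦋0⦌)

lemma limitToCobar_comp_d (X : SimplexCategory ⥤ J) (F : J ⥤ ModuleCat.{u + 1} K) :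
    limitToCobar X F ≫ ((cobar K X).obj F).d 0 1 = 0 := by
  exact (comp_cobar_d_zero _).trans
    (sub_eq_zero.2 ((limit.w F _).trans (limit.w F _).symm))

/-- The map to the limit of a diagram given by a cocycle of degree `0` of its cobar complex. -/
def liftLimit {F : J ⥤ ModuleCat.{u + 1} K} {M : ModuleCat.{u + 1} K}
    (g : M ⟶ F.obj (X.obj ⦋0⦌)) (hg : g ≫ ((cobar K X).obj F).d 0 1 = 0) : M ⟶ limit F :=
  limit.lift F
    { pt := M
      π :=
        { app := fun j => g ≫ F.map (hX.nonempty j).some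
          naturality := fun i j φ => by
            rw [Category.assoc, ← Functor.map_comp]
            exact (Category.id_comp _).trans
              (comp_map_eq_of_comp_cobar_d_eq_zero hX g hg _ _) } }

lemma liftLimit_π {F : J ⥤ ModuleCat.{u + 1} K} {M : ModuleCat.{u + 1} K}
    (g : M ⟶ F.obj (X.obj ⦋0⦌)) (hg : g ≫ ((cobar K X).obj F).d 0 1 = 0) :
    liftLimit hX g hg ≫ limit.π F (X.obj ⦋0⦌) = g := by
  rw [liftLimit, limit.lift_π]
  refine (comp_map_eq_of_comp_cobar_d_eq_zero hX g hg _ (𝟙 _)).trans ?_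
  rw [F.map_id, Category.comp_id]

include hX in
lemma limit_hom_ext_bottom {F : J ⥤ ModuleCat.{u + 1} K} {M : ModuleCat.{u + 1} K}
    {f g : M ⟶ limit F} (h : f ≫ limit.π F (X.obj ⦋0⦌) = g ≫ limit.π F (X.obj ⦋0⦌)) : f = g :=
  limit.hom_ext fun j => by
    rw [← limit.w F (hX.nonempty j).some, reassoc_of% h]

/-- The limit of a diagram is the kernel of the first differential of its cobar complex. -/
def limitIsKernel (F : J ⥤ ModuleCat.{u + 1} K) :
    IsLimit (KernelFork.ofι (limitToCobar X F) (limitToCobar_comp_d X F)) :=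
  KernelFork.IsLimit.ofι _ _ (fun g hg => liftLimit hX g hg) (fun g hg => liftLimit_π hX g hg)
    (fun g hg _ hm => limit_hom_ext_bottom hX (hm.trans (liftLimit_π hX g hg).symm))

/-- The limit of a diagram is isomorphic to the cocycles in degree `0` of its cobar complex. -/
def limitIsoCycles (F : J ⥤ ModuleCat.{u + 1} K) : limit F ≅ ((cobar K X).obj F).cycles 0 :=
  (limitIsKernel hX F).conePointUniqueUpToIso
    (((cobar K X).obj F).cyclesIsKernel 0 1 (by simp))

lemma limitIsoCycles_hom_comp_iCycles (F : J ⥤ ModuleCat.{u + 1} K) :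
    (limitIsoCycles hX F).hom ≫ ((cobar K X).obj F).iCycles 0 = limitToCobar X F :=
  IsLimit.conePointUniqueUpToIso_hom_comp _ _ WalkingParallelPair.zero

lemma limMap_comp_limitToCobar {F G : J ⥤ ModuleCat.{u + 1} K} (φ : F ⟶ G) :
    limMap φ ≫ limitToCobar X G = limitToCobar X F ≫ ((cobar K X).map φ).f 0 :=
  limMap_π _ _

/-- The limit of a diagram is the cohomology in degree `0` of its cobar complex. -/
def limitIsoHomology (F : J ⥤ ModuleCat.{u + 1} K) :
    lim.obj F ≅ ((cobar K X).obj F).homology 0 :=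
  limitIsoCycles hX F ≪≫ CochainComplex.isoHomologyπ₀ _

lemma limitIsoHomology_naturality {F G : J ⥤ ModuleCat.{u + 1} K} (φ : F ⟶ G) :
    lim.map φ ≫ (limitIsoHomology hX G).hom = (limitIsoHomology hX F).hom ≫
      HomologicalComplex.homologyMap ((cobar K X).map φ) 0 := by
  have h : lim.map φ ≫ (limitIsoCycles hX G).hom =
      (limitIsoCycles hX F).hom ≫ HomologicalComplex.cyclesMap ((cobar K X).map φ) 0 := by
    rw [← cancel_mono (((cobar K X).obj G).iCycles 0), Category.assoc, Category.assoc,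
      limitIsoCycles_hom_comp_iCycles, HomologicalComplex.cyclesMap_i,
      reassoc_of% (limitIsoCycles_hom_comp_iCycles hX F)]
    exact limMap_comp_limitToCobar φ
  rw [limitIsoHomology, limitIsoHomology, Iso.trans_hom, Iso.trans_hom, reassoc_of% h,
    Category.assoc, HomologicalComplex.isoHomologyπ_hom, HomologicalComplex.isoHomologyπ_hom,
    HomologicalComplex.homologyπ_naturality]

end LimCobar

end RelationLimits

end

noncomputable section

namespace RelationLimits

/-! ### Left exact functors and cocycles of a resolution -/

section LeftExact

variable {C D : Type*} [Category* C] [Category* D] [Abelian C] [Abelian D]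

lemma shortComplex_cycles_zero (L : CochainComplex C ℕ) (n : ℕ) :
    L.iCycles n ≫ L.toCycles n (n + 1) = 0 := by
  rw [← cancel_mono (L.iCycles (n + 1)), Category.assoc, L.toCycles_i, L.iCycles_d, zero_comp]

/-- The short complex `Zⁿ ⟶ Lⁿ ⟶ Zⁿ⁺¹` of a cochain complex `L` with cocycles `Z`. -/
abbrev shortComplexCycles (L : CochainComplex C ℕ) (n : ℕ) : ShortComplex C :=
  ShortComplex.mk (L.iCycles n) (L.toCycles n (n + 1)) (shortComplex_cycles_zero L n)

lemma shortExact_shortComplexCycles (L : CochainComplex C ℕ) (n : ℕ) (hL : L.ExactAt (n + 1)) :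
    (shortComplexCycles L n).ShortExact where
  exact := ShortComplex.exact_of_f_is_kernel _
    (isKernelOfComp (f := L.toCycles n (n + 1)) (L.iCycles (n + 1)) (L.d n (n + 1))
      (L.cyclesIsKernel n (n + 1) (by simp)) (shortComplex_cycles_zero L n)
      (L.toCycles_i n (n + 1)))
  epi_g := Preadditive.epi_of_isZero_cokernel' _
    (L.homologyIsCokernel n (n + 1) (by simp)) hL.isZero_homology

/-- The cohomology of the image of a complex under a left exact functor `F`, in terms of the
images of its cocycles. -/
def mapHomologyIsoCokernel (F : C ⥤ D) [F.Additive] [PreservesFiniteLimits F]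
    (L : CochainComplex C ℕ) (n : ℕ) :
    ((F.mapHomologicalComplex _).obj L).homology (n + 1) ≅
      cokernel (F.map (L.toCycles n (n + 1))) :=
  have hk : IsLimit (KernelFork.ofι (f := F.map (L.d (n + 1) (n + 2))) (F.map (L.iCycles (n + 1)))
      (by rw [← F.map_comp, L.iCycles_d, F.map_zero])) :=
    isLimitForkMapOfIsLimit' F _ (L.cyclesIsKernel (n + 1) (n + 2) (by simp))
  have hl : hk.lift (KernelFork.ofι (F.map (L.d n (n + 1)))
      (by rw [← F.map_comp, L.d_comp_d, F.map_zero])) = F.map (L.toCycles n (n + 1)) :=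
    Fork.IsLimit.hom_ext hk (by
      rw [Fork.IsLimit.lift_ι]
      exact (congrArg F.map (L.toCycles_i n (n + 1)).symm).trans (F.map_comp _ _))
  let h : (((F.mapHomologicalComplex (ComplexShape.up ℕ)).obj L).sc' n (n + 1)
      (n + 2)).LeftHomologyData :=
    { K := F.obj (L.cycles (n + 1))
      H := cokernel (F.map (L.toCycles n (n + 1)))
      i := F.map (L.iCycles (n + 1))
      π := cokernel.π _
      wi := by
        change F.map _ ≫ F.map (L.d (n + 1) (n + 2)) = 0
        rw [← F.map_comp, L.iCycles_d, F.map_zero]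
      hi := hk
      wπ := (congrArg (· ≫ cokernel.π _) hl).trans (cokernel.condition _)
      hπ := CokernelCofork.IsColimit.ofπ _ _
        (fun g hg => cokernel.desc _ g ((congrArg (· ≫ g) hl).symm.trans hg))
        (fun _ _ => cokernel.π_desc _ _ _)
        (fun _ _ _ hm => coequalizer.hom_ext (hm.trans (cokernel.π_desc _ _ _).symm)) }
  ShortComplex.homologyMapIso (((F.mapHomologicalComplex (ComplexShape.up ℕ)).obj L).isoSc' n (n + 1)
    (n + 2) (by simp) (by simp)) ≪≫ h.homologyIso

end LeftExact

/-! ### Derived limits by dimension shifting -/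

section DerivedLimits

open AlgebraicTopology Simplicial

variable {K : Type u} [CommRing K] {J : Type (u + 1)} [Category.{u} J]
  {X : SimplexCategory ⥤ J} (hX : IsCopowerSystem X)

include hX in
lemma isZero_homology_cobar (I : J ⥤ ModuleCat.{u + 1} K) [Injective I] (n : ℕ) :
    IsZero (((cobar K X).obj I).homology (n + 1)) :=
  (cobar_exactAt_of_injective hX I n).isZero_homology

/-- Dimension shifting for the cohomology of the cobar complex. -/
def cobarHomologyShift {S : ShortComplex (J ⥤ ModuleCat.{u + 1} K)} (hS : S.ShortExact)
    [Injective S.X₂] (n : ℕ) : ((cobar K X).obj S.X₃).homology (n + 1) ≅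
      ((cobar K X).obj S.X₁).homology (n + 2) :=
  (cobar_shortExact X S hS).δIso (n + 1) (n + 2) (by simp)
    (isZero_homology_cobar hX S.X₂ n) (isZero_homology_cobar hX S.X₂ (n + 1))

/-- The cohomology of the cobar complex in degree `1` as a cokernel of a map of limits. -/
def cobarHomologyOneIso {S : ShortComplex (J ⥤ ModuleCat.{u + 1} K)} (hS : S.ShortExact)
    [Injective S.X₂] : cokernel (lim.map S.g) ≅ ((cobar K X).obj S.X₁).homology 1 :=
  have := (cobar_shortExact X S hS).epi_δ 0 1 rfl (isZero_homology_cobar hX S.X₂ 0)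
  cokernel.mapIso _ _ (limitIsoHomology hX _) (limitIsoHomology hX _)
    (limitIsoHomology_naturality hX S.g) ≪≫
    (colimit.isColimit _).coconePointUniqueUpToIso
      ((cobar_shortExact X S hS).homology_exact₃ 0 1 rfl).gIsCokernel

-- The sequences `0 → Zⁿ → Lⁿ → Zⁿ⁺¹ → 0` have injective middle term, so each step trades one cobar
-- degree for one cocycle degree. In cobar degree `1` both sides are the cokernel of `lim Lⁿ → lim
-- Zⁿ⁺¹`.
include hX in
lemma nonempty_homology_cobar_cycles_iso (L : CochainComplex (J ⥤ ModuleCat.{u + 1} K) ℕ)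
    (hL : ∀ n, L.ExactAt (n + 1)) (hI : ∀ n, Injective (L.X n)) (k : ℕ) (n : ℕ) :
    Nonempty (((cobar K X).obj (L.cycles n)).homology (k + 1) ≅
      ((lim.mapHomologicalComplex _).obj L).homology (k + n + 1)) := by
  induction k generalizing n with
  | zero =>
    have hS := shortExact_shortComplexCycles L n (hL n)
    have := hI n
    exact ⟨(cobarHomologyOneIso hX hS).symm ≪≫ (mapHomologyIsoCokernel lim L n).symm ≪≫
      eqToIso (by rw [Nat.zero_add])⟩
  | succ k ih =>
    have hS := shortExact_shortComplexCycles L n (hL n)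
    have := hI n
    obtain ⟨e⟩ := ih (n + 1)
    exact ⟨(cobarHomologyShift hX hS k).symm ≪≫ e ≪≫
      eqToIso (by rw [show k + (n + 1) + 1 = k + 1 + n + 1 by omega])⟩

include hX in
/-- The derived limits of a diagram are the cohomology of its cobar complex. -/
theorem nonempty_rightDerived_lim_iso (F : J ⥤ ModuleCat.{u + 1} K) (i : ℕ) :
    Nonempty (((lim : (J ⥤ ModuleCat.{u + 1} K) ⥤ _).rightDerived i).obj F ≅
      ((cobar K X).obj F).homology i) := by
  cases i with
  | zero => exact ⟨lim.rightDerivedZeroIsoSelf.app F ≪≫ limitIsoHomology hX F⟩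
  | succ i =>
    obtain ⟨I⟩ := HasInjectiveResolution.out (Z := F)
    -- The case of the degree `0` cocycles, which are `F` itself.
    obtain ⟨e⟩ := nonempty_homology_cobar_cycles_iso hX I.cocomplex I.cocomplex_exactAt_succ
      I.injective i 0
    have e' : F ≅ I.cocomplex.cycles 0 := I.isLimitKernelFork.conePointUniqueUpToIso
      (I.cocomplex.cyclesIsKernel 0 1 (by simp))
    exact ⟨I.isoRightDerivedObj _ _ ≪≫ e.symm ≪≫
      (HomologicalComplex.homologyFunctor _ _ _).mapIso ((cobar K X).mapIso e'.symm)⟩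

end DerivedLimits

end RelationLimits

end

noncomputable section

namespace RelationLimits

open AlgebraicTopology Simplicial Opposite

/-! ### The décalage of a simplicial object and its contraction -/

section Decalage

/-- The functor `[n] ↦ [n + 1]` which adds a new least element. -/
def addBottom : SimplexCategory ⥤ SimplexCategory where
  obj n := ⦋n.len + 1⦌
  map {m n} f := SimplexCategory.mkHom
    ⟨Fin.cons (α := fun _ => Fin (n.len + 1 + 1)) 0 fun k => (f.toOrderHom k).succ, by
      intro a b hab
      induction a using Fin.cases with
      | zero => simp
      | succ a =>
        induction b using Fin.cases with
        | zero => simp at hab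
        | succ b => simpa using f.toOrderHom.monotone (Fin.succ_le_succ_iff.1 hab)⟩
  map_id n := by
    ext k : 3
    induction k using Fin.cases <;> rfl
  map_comp f g := by
    ext k : 3
    induction k using Fin.cases <;> rfl

/-- The inclusions `[n] ⟶ [n + 1]` which avoid the new least element. -/
def toAddBottom : 𝟭 SimplexCategory ⟶ addBottom where
  app n := SimplexCategory.δ (n := n.len) 0
  naturality _ _ f := by
    ext k : 3
    rfl

lemma addBottom_map_δ {n : ℕ} (i : Fin (n + 2)) :
    addBottom.map (SimplexCategory.δ i) = SimplexCategory.δ i.succ := by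
  ext k : 3
  induction k using Fin.cases with
  | zero => rfl
  | succ k => exact (Fin.succ_succAbove_succ i k).symm

lemma addBottom_map_σ {n : ℕ} (i : Fin (n + 1)) :
    addBottom.map (SimplexCategory.σ i) = SimplexCategory.σ i.succ := by
  ext k : 3
  induction k using Fin.cases with
  | zero => rfl
  | succ k => exact (Fin.succ_predAbove_succ i k).symm

variable {C : Type*} [Category* C]

/-- The décalage of a simplicial object, with the face map `δ 0` left out. -/
def dec (W : SimplicialObject C) : SimplicialObject C := addBottom.op ⋙ W

/-- The map from the décalage to the simplicial object which is given by the face map `δ 0`. -/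
def decToSelf (W : SimplicialObject C) : dec W ⟶ W where
  app n := W.map (toAddBottom.app n.unop).op
  naturality m n f := by
    dsimp only [dec, Functor.comp_map, Functor.op_map]
    rw [← W.map_comp, ← W.map_comp, ← op_comp, ← Quiver.Hom.op_unop f, ← op_comp]
    exact congrArg (fun φ => W.map φ.op) (toAddBottom.naturality f.unop)

lemma dec_δ (W : SimplicialObject C) {n : ℕ} (i : Fin (n + 2)) :
    (dec W).δ i = W.δ i.succ :=
  congrArg (fun φ : ⦋n + 1⦌ ⟶ ⦋n + 2⦌ => W.map φ.op) (addBottom_map_δ i)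

lemma dec_σ (W : SimplicialObject C) {n : ℕ} (i : Fin (n + 1)) :
    (dec W).σ i = W.σ i.succ :=
  congrArg (fun φ : ⦋n + 2⦌ ⟶ ⦋n + 1⦌ => W.map φ.op) (addBottom_map_σ i)

/-- The décalage augmented over the object of vertices. -/
def augmentedDec (W : SimplicialObject C) : SimplicialObject.Augmented C :=
  SimplicialObject.augment (dec W) (W _⦋0⦌) (W.δ 1) fun n g₁ g₂ => by
    -- Each composite is restriction to the added vertex, whatever `g` is.
    have h : ∀ g : ⦋0⦌ ⟶ n, (dec W).map g.op ≫ W.δ 1 =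
        W.map (SimplexCategory.const ⦋0⦌ (addBottom.obj n) 0).op := fun g => by
      rw [SimplicialObject.δ_def, SimplexCategory.δ_one_eq_const]
      refine (W.map_comp _ _).symm.trans (congrArg W.map ?_)
      exact Quiver.Hom.unop_inj (SimplexCategory.eq_const_of_zero _)
    rw [h, h]

lemma augmentedDec_hom_app_zero (W : SimplicialObject C) :
    (augmentedDec W).hom.app (op ⦋0⦌) = W.δ 1 :=
  SimplicialObject.augment_hom_zero _ _ _ _

/-- The degeneracy `σ 0` is an extra degeneracy for the décalage. -/
def augmentedDecExtraDegeneracy (W : SimplicialObject C) : (augmentedDec W).ExtraDegeneracy where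
  s' := W.σ 0
  s n := W.σ 0
  s'_comp_ε := by
    exact (congrArg (W.σ 0 ≫ ·) (augmentedDec_hom_app_zero W)).trans W.δ_comp_σ_succ
  s₀_comp_δ₁ := by
    change W.σ 0 ≫ (dec W).δ 1 = (augmentedDec W).hom.app (op ⦋0⦌) ≫ W.σ 0
    rw [dec_δ]
    exact (W.δ_comp_σ_of_gt (i := 1) (j := 0) (by simp)).trans
      (congrArg (· ≫ W.σ 0) (augmentedDec_hom_app_zero W)).symm
  s_comp_δ₀ n := by
    change W.σ 0 ≫ (dec W).δ 0 = _
    rw [dec_δ]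
    exact W.δ_comp_σ_succ
  s_comp_δ n i := by
    change W.σ 0 ≫ (dec W).δ i.succ = (dec W).δ i ≫ W.σ 0
    rw [dec_δ, dec_δ]
    exact W.δ_comp_σ_of_gt (i := i.succ) (j := 0) (Fin.succ_pos i)
  s_comp_σ n i := by
    change W.σ 0 ≫ (dec W).σ i.succ = (dec W).σ i ≫ W.σ 0
    rw [dec_σ, dec_σ]
    exact (W.σ_comp_σ (Fin.zero_le i.succ)).symm

end Decalage

/-! ### Addition of simplicial homotopies -/

section HomotopyAdd

variable {C : Type*} [Category* C] [Preadditive C] {X Y : SimplicialObject C}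

/-- The sum of two simplicial homotopies. -/
def addHomotopy {f g f' g' : X ⟶ Y} (H : SimplicialObject.Homotopy f g)
    (H' : SimplicialObject.Homotopy f' g') : SimplicialObject.Homotopy (f + f') (g + g') where
  h i := H.h i + H'.h i
  h_zero_comp_δ_zero n := by simp [Preadditive.add_comp]
  h_last_comp_δ_last n := by simp [Preadditive.add_comp]
  h_succ_comp_δ_castSucc_of_lt i j hij := by
    simp [Preadditive.add_comp, Preadditive.comp_add, hij]
  h_succ_comp_δ_castSucc_succ j := by
    simp only [Preadditive.add_comp, H.h_succ_comp_δ_castSucc_succ, H'.h_succ_comp_δ_castSucc_succ]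
  h_castSucc_comp_δ_succ_of_lt i j hji := by
    simp [Preadditive.add_comp, Preadditive.comp_add, hji]
  h_comp_σ_castSucc_of_le i j hij := by
    simp [Preadditive.add_comp, Preadditive.comp_add, hij]
  h_comp_σ_succ_of_lt i j hji := by
    simp [Preadditive.add_comp, Preadditive.comp_add, hji]

end HomotopyAdd

end RelationLimits

end

noncomputable section

namespace RelationLimits

open AlgebraicTopology Simplicial Opposite

/-! ### Maps into the normalized complex -/

section Moore

open Subobject

variable {A : Type*} [Category* A] [Abelian A]

/-- The inclusion of the normalized complex, in degree `n`. -/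
def mooreι (W : SimplicialObject A) (n : ℕ) :
    ((normalizedMooreComplex A).obj W).X n ⟶ W _⦋n⦌ :=
  (NormalizedMooreComplex.objX W n).arrow

instance (W : SimplicialObject A) (n : ℕ) : Mono (mooreι W n) :=
  Subobject.arrow_mono _

instance (W : SimplicialObject A) : IsIso (mooreι W 0) := by
  change IsIso (⊤ : Subobject (W _⦋0⦌)).arrow
  infer_instance

lemma mooreι_comp_δ_succ (W : SimplicialObject A) (n : ℕ) (k : Fin (n + 1)) :
    mooreι W (n + 1) ≫ W.δ k.succ = 0 := by
  change (NormalizedMooreComplex.objX W (n + 1)).arrow ≫ _ = 0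
  rw [NormalizedMooreComplex.objX_add_one,
    ← factorThru_arrow _ _ (finset_inf_arrow_factors Finset.univ _ k (Finset.mem_univ k)),
    Category.assoc, kernelSubobject_arrow_comp, comp_zero]

/-- On the normalized part all faces but `δ 0` vanish, so only one term of the alternating sum
survives. -/
lemma d_comp_mooreι (W : SimplicialObject A) (n : ℕ) :
    ((normalizedMooreComplex A).obj W).d (n + 1) n ≫ mooreι W n = mooreι W (n + 1) ≫ W.δ 0 := by
  have := (inclusionOfMooreComplexMap W).comm (n + 1) n
  rw [inclusionOfMooreComplexMap_f, inclusionOfMooreComplexMap_f] at this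
  refine this.symm.trans ?_
  change mooreι W (n + 1) ≫ ((alternatingFaceMapComplex A).obj W).d (n + 1) n = _
  rw [alternatingFaceMapComplex_obj_d, AlternatingFaceMapComplex.objD, Fin.sum_univ_succ,
    Preadditive.comp_add, Preadditive.comp_sum, Fintype.sum_eq_zero, add_zero]
  · simp
  · intro k
    rw [Preadditive.comp_zsmul, mooreι_comp_δ_succ, smul_zero]

lemma map_f_comp_mooreι {V W : SimplicialObject A} (f : V ⟶ W) (n : ℕ) :
    ((normalizedMooreComplex A).map f).f n ≫ mooreι W n = mooreι V n ≫ f.app (op ⦋n⦌) :=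
  (congrArg (fun ψ => ψ.f n) ((inclusionOfMooreComplex A).naturality f) :)

/-- Maps which are killed by the higher faces factor through the normalized complex. -/
lemma exists_comp_mooreι_eq {W : SimplicialObject A} {n : ℕ} {Z : A} (t : Z ⟶ W _⦋n + 1⦌)
    (ht : ∀ k : Fin (n + 1), t ≫ W.δ k.succ = 0) : ∃ s, s ≫ mooreι W (n + 1) = t :=
  ⟨factorThru _ t ((finset_inf_factors _).2 fun k _ => kernelSubobject_factors _ _ (ht k)),
    factorThru_arrow _ _ _⟩

/-- A chain map into the normalized complex, from maps which are killed by the higher faces. -/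
lemma exists_chainMap_comp_mooreι_eq {P : ChainComplex A ℕ} {W : SimplicialObject A}
    (t : ∀ n, P.X n ⟶ W _⦋n⦌) (ht : ∀ n (k : Fin (n + 1)), t (n + 1) ≫ W.δ k.succ = 0)
    (hd : ∀ n, t (n + 1) ≫ W.δ 0 = P.d (n + 1) n ≫ t n) :
    ∃ T : P ⟶ (normalizedMooreComplex A).obj W, ∀ n, T.f n ≫ mooreι W n = t n := by
  have h : ∀ n, ∃ s, s ≫ mooreι W n = t n := fun n => by
    cases n with
    | zero => exact ⟨t 0 ≫ inv (mooreι W 0), by simp⟩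
    | succ n => exact exists_comp_mooreι_eq (t (n + 1)) (ht n)
  choose s hs using h
  refine ⟨{ f := s, comm' := ?_ }, hs⟩
  rintro _ n rfl
  rw [← cancel_mono (mooreι W n), Category.assoc, Category.assoc, hs, d_comp_mooreι,
    reassoc_of% (hs (n + 1)), hd]

end Moore

/-! ### From chain homotopies to simplicial homotopies -/

section DoldKan

variable {A : Type*} [Category* A] [Abelian A] {V W : SimplicialObject A}

instance : (normalizedMooreComplex A).IsEquivalence :=
  (Abelian.DoldKan.equivalence (A := A)).isEquivalence_functor

lemma mooreι_comp_eq_zero {n : ℕ} {Z : A} (s : Z ⟶ ((normalizedMooreComplex A).obj W).X (n + 1))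
    (k : Fin (n + 1)) : (s ≫ mooreι W (n + 1)) ≫ W.δ k.succ = 0 := by
  rw [Category.assoc, mooreι_comp_δ_succ, comp_zero]

/-- The components, on the normalized complex of `V`, of the lift of a null-homotopic map
`V ⟶ W` to the décalage of `W`. -/
def liftDecComponent (h : ∀ n, ((normalizedMooreComplex A).obj V).X n ⟶
    ((normalizedMooreComplex A).obj W).X (n + 1)) :
    ∀ n, ((normalizedMooreComplex A).obj V).X n ⟶ W _⦋n + 1⦌
  | 0 => h 0 ≫ mooreι W 1
  -- The first summand alone is killed by `δ 1`, while a chain map into the décalage, whose zeroth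
  -- face is `δ 1`, needs `d` followed by the previous component. The `σ 0` term supplies this, and
  -- under `δ 0` it adds the missing `d h` to `h d`.
  | n + 1 => h (n + 1) ≫ mooreι W (n + 2) +
      ((normalizedMooreComplex A).obj V).d (n + 1) n ≫ (h n ≫ mooreι W (n + 1)) ≫ W.σ 0

section

variable (h : ∀ n, ((normalizedMooreComplex A).obj V).X n ⟶
    ((normalizedMooreComplex A).obj W).X (n + 1))

lemma liftDecComponent_comp_δ_succ_succ (n : ℕ) (k : Fin (n + 1)) :
    liftDecComponent h (n + 1) ≫ W.δ k.succ.succ = 0 := by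
  rw [liftDecComponent, Preadditive.add_comp, mooreι_comp_eq_zero, zero_add, Category.assoc,
    Category.assoc]
  have : W.σ 0 ≫ W.δ k.succ.succ = W.δ k.succ ≫ W.σ 0 :=
    W.δ_comp_σ_of_gt (i := k.succ) (j := 0) (Fin.succ_pos k)
  rw [this, ← Category.assoc (_ ≫ _), mooreι_comp_eq_zero, zero_comp, comp_zero]

lemma d_comp_liftDecComponent (n : ℕ) :
    ((normalizedMooreComplex A).obj V).d (n + 1) n ≫ liftDecComponent h n =
      ((normalizedMooreComplex A).obj V).d (n + 1) n ≫ h n ≫ mooreι W (n + 1) := by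
  cases n with
  | zero => rfl
  | succ n =>
    rw [liftDecComponent, Preadditive.comp_add, HomologicalComplex.d_comp_d_assoc, zero_comp,
      add_zero]

lemma liftDecComponent_comp_δ_one (n : ℕ) :
    liftDecComponent h (n + 1) ≫ W.δ 1 =
      ((normalizedMooreComplex A).obj V).d (n + 1) n ≫ liftDecComponent h n := by
  have h1 : (h (n + 1) ≫ mooreι W (n + 2)) ≫ W.δ 1 = 0 := mooreι_comp_eq_zero _ 0
  have h2 : W.σ 0 ≫ W.δ (1 : Fin (n + 3)) = 𝟙 _ := W.δ_comp_σ_succ (i := 0)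
  rw [d_comp_liftDecComponent, liftDecComponent, Preadditive.add_comp, h1, zero_add,
    Category.assoc, Category.assoc, h2, Category.comp_id]

lemma liftDecComponent_zero_comp_δ_one : liftDecComponent h 0 ≫ W.δ 1 = 0 :=
  mooreι_comp_eq_zero _ 0

lemma liftDecComponent_zero_comp_δ_zero :
    liftDecComponent h 0 ≫ W.δ 0 =
      (h 0 ≫ ((normalizedMooreComplex A).obj W).d 1 0) ≫ mooreι W 0 := by
  rw [Category.assoc, d_comp_mooreι, liftDecComponent, Category.assoc]

lemma liftDecComponent_succ_comp_δ_zero (n : ℕ) :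
    liftDecComponent h (n + 1) ≫ W.δ 0 =
      (((normalizedMooreComplex A).obj V).d (n + 1) n ≫ h n +
        h (n + 1) ≫ ((normalizedMooreComplex A).obj W).d (n + 2) (n + 1)) ≫ mooreι W (n + 1) := by
  have h2 : W.σ 0 ≫ W.δ (0 : Fin (n + 3)) = 𝟙 _ := W.δ_comp_σ_self (i := 0)
  rw [Preadditive.add_comp, Category.assoc, Category.assoc, d_comp_mooreι, liftDecComponent,
    Preadditive.add_comp, Category.assoc, Category.assoc, Category.assoc, h2, Category.comp_id]
  exact add_comm _ _

end

/-- Faithfulness in the Dold–Kan correspondence. -/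
lemma hom_ext_of_mooreι {f g : V ⟶ W}
    (h : ∀ n, mooreι V n ≫ f.app (op ⦋n⦌) = mooreι V n ≫ g.app (op ⦋n⦌)) : f = g := by
  refine (normalizedMooreComplex A).map_injective (HomologicalComplex.hom_ext _ _ fun n => ?_)
  rw [← cancel_mono (mooreι W n), map_f_comp_mooreι, map_f_comp_mooreι, h]

lemma hom_const_eq_zero {B : A} {f : V ⟶ (SimplicialObject.const A).obj B}
    (h : f.app (op ⦋0⦌) = 0) : f = 0 := by
  ext n
  have := f.naturality (SimplexCategory.const ⦋0⦌ n.unop 0).op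
  rw [h, comp_zero] at this
  exact ((Category.comp_id _).symm.trans this.symm)

/-- A null-homotopy of the map induced by `φ` on normalized complexes lifts `φ` to the
décalage. -/
lemma exists_lift_dec {φ : V ⟶ W} (H : Homotopy ((normalizedMooreComplex A).map φ) 0) :
    ∃ t : V ⟶ dec W, t ≫ decToSelf W = φ ∧ t ≫ (augmentedDec W).hom = 0 := by
  let h (n : ℕ) : ((normalizedMooreComplex A).obj V).X n ⟶
    ((normalizedMooreComplex A).obj W).X (n + 1) := H.hom n (n + 1)
  obtain ⟨T, hT⟩ := exists_chainMap_comp_mooreι_eq (W := dec W) (liftDecComponent h)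
    (fun n k => (congrArg _ (dec_δ W k.succ)).trans (liftDecComponent_comp_δ_succ_succ h n k))
    (fun n => (congrArg _ (dec_δ W 0)).trans (liftDecComponent_comp_δ_one h n))
  obtain ⟨t, rfl⟩ := (normalizedMooreComplex A).map_surjective T
  have ht (n : ℕ) : mooreι V n ≫ t.app (op ⦋n⦌) = liftDecComponent h n := by
    rw [← map_f_comp_mooreι, hT]
  refine ⟨t, hom_ext_of_mooreι fun n => ?_, hom_const_eq_zero ?_⟩
  · have hφ : liftDecComponent h n ≫ W.δ 0 = mooreι V n ≫ φ.app (op ⦋n⦌) := by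
      rw [← map_f_comp_mooreι, H.comm n]
      cases n with
      | zero =>
        rw [Homotopy.dNext_zero_chainComplex, Homotopy.prevD_chainComplex,
          liftDecComponent_zero_comp_δ_zero]
        simp [h]
      | succ n =>
        rw [Homotopy.dNext_succ_chainComplex, Homotopy.prevD_chainComplex,
          liftDecComponent_succ_comp_δ_zero]
        simp [h]
    exact (Category.assoc _ _ _).symm.trans ((congrArg (· ≫ W.δ 0) (ht n)).trans hφ)
  · rw [← cancel_epi (mooreι V 0), comp_zero]
    exact (Category.assoc _ _ _).symm.trans ((congrArg₂ (· ≫ ·) (ht 0)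
      (augmentedDec_hom_app_zero W)).trans (liftDecComponent_zero_comp_δ_one h))

/-- If two maps of simplicial objects induce homotopic maps on the normalized complexes, then
they are simplicially homotopic. -/
theorem nonempty_homotopy_of_moore {f g : V ⟶ W}
    (H : Homotopy ((normalizedMooreComplex A).map f) ((normalizedMooreComplex A).map g)) :
    Nonempty (SimplicialObject.Homotopy g f) := by
  have : (normalizedMooreComplex A).map (f - g) =
      (normalizedMooreComplex A).map f - (normalizedMooreComplex A).map g := by
    ext n
    rw [← cancel_mono (mooreι W n), map_f_comp_mooreι, HomologicalComplex.sub_f_apply,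
      Preadditive.sub_comp, map_f_comp_mooreι, map_f_comp_mooreι, ← Preadditive.comp_sub]
    rfl
  obtain ⟨t, h1, h2⟩ := exists_lift_dec ((Homotopy.ofEq this).trans H.equivSubZero)
  -- The identity of the décalage is homotopic to a map through the augmentation. Inserted between
  -- the lift `t`, which the augmentation kills, and `decToSelf`, this becomes a homotopy between
  -- `0` and `f - g`; the constant homotopy of `g` is then added.
  have H1 := ((augmentedDecExtraDegeneracy W).homotopy.precomp t).postcomp (decToSelf W)
  have h3 : (t ≫ (augmentedDec W).hom ≫ (augmentedDecExtraDegeneracy W).section_) ≫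
      decToSelf W = 0 := by
    refine (congrArg (· ≫ decToSelf W) ((Category.assoc _ _ _).symm.trans
      (congrArg (· ≫ (augmentedDecExtraDegeneracy W).section_) h2))).trans ?_
    exact (congrArg (· ≫ decToSelf W) zero_comp).trans zero_comp
  have h4 : (t ≫ 𝟙 (augmentedDec W).left) ≫ decToSelf W = f - g :=
    (congrArg (· ≫ decToSelf W) (Category.comp_id t)).trans h1
  have H2 : SimplicialObject.Homotopy (0 : V ⟶ W) (f - g) := h3 ▸ h4 ▸ H1
  have H3 := addHomotopy H2 (SimplicialObject.Homotopy.refl g)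
  rw [zero_add, sub_add_cancel] at H3
  exact ⟨H3⟩

/-- A non-additive `Φ` need not respect chain homotopies, so the homotopy is first made simplicial,
and `Φ` is applied degreewise to that. -/
lemma homology_map_whiskering_eq_id {D : Type*} [Category* D] [Abelian D] (Φ : A ⥤ D)
    (f : V ⟶ V) (H : Homotopy ((normalizedMooreComplex A).map f) (𝟙 _)) (i : ℕ) :
    HomologicalComplex.homologyMap ((alternatingFaceMapComplex D).map
      (((SimplicialObject.whiskering A D).obj Φ).map f)) i = 𝟙 _ := by
  obtain ⟨H'⟩ := nonempty_homotopy_of_moore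
    (H.trans (Homotopy.ofEq ((normalizedMooreComplex A).map_id V).symm))
  refine ((H'.whiskerRight Φ).map_homology_eq i).symm.trans ?_
  rw [CategoryTheory.Functor.map_id, CategoryTheory.Functor.map_id,
    CategoryTheory.Functor.map_id]
  rfl

/-- If the normalized complexes of two simplicial objects are homotopy equivalent, then any
functor takes the simplicial objects to ones with isomorphic homotopy. -/
theorem nonempty_homology_whiskering_iso {D : Type*} [Category* D] [Abelian D] (Φ : A ⥤ D)
    (e : HomotopyEquiv ((normalizedMooreComplex A).obj V) ((normalizedMooreComplex A).obj W))
    (i : ℕ) :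
    Nonempty (((alternatingFaceMapComplex D).obj
        (((SimplicialObject.whiskering A D).obj Φ).obj V)).homology i ≅
      ((alternatingFaceMapComplex D).obj
        (((SimplicialObject.whiskering A D).obj Φ).obj W)).homology i) := by
  obtain ⟨f, hf⟩ := (normalizedMooreComplex A).map_surjective e.hom
  obtain ⟨g, hg⟩ := (normalizedMooreComplex A).map_surjective e.inv
  let Ψ := (SimplicialObject.whiskering A D).obj Φ ⋙ alternatingFaceMapComplex D
  refine ⟨⟨HomologicalComplex.homologyMap (Ψ.map f) i, HomologicalComplex.homologyMap (Ψ.map g) i,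
    ?_, ?_⟩⟩
  · rw [← HomologicalComplex.homologyMap_comp, ← Functor.map_comp]
    exact homology_map_whiskering_eq_id Φ _
      ((Homotopy.ofEq (by rw [Functor.map_comp, hf, hg])).trans e.homotopyHomInvId) i
  · rw [← HomologicalComplex.homologyMap_comp, ← Functor.map_comp]
    exact homology_map_whiskering_eq_id Φ _
      ((Homotopy.ofEq (by rw [Functor.map_comp, hf, hg])).trans e.homotopyInvHomId) i

end DoldKan

end RelationLimits

end

noncomputable section

namespace RelationLimits

open AlgebraicTopology Simplicial Opposite ZeroObject

/-! ### Dold–Puppe functors from arbitrary simplicial resolutions -/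

section Resolution

variable {C : Type*} [Category* C] [Abelian C]

/-- In a short exact sequence of complexes, the second map is a quasi-isomorphism if the first
complex is acyclic. -/
lemma quasiIso_g_of_acyclic {ι : Type*} {c : ComplexShape ι}
    {S : ShortComplex (HomologicalComplex C c)} (hS : S.ShortExact) (h : S.X₁.Acyclic) :
    QuasiIso S.g := by
  -- Compare `S` with `0 → X₂ = X₂`: quasi-isomorphisms on the first two terms force one on the
  -- third.
  let T : ShortComplex (HomologicalComplex C c) :=
    ShortComplex.mk (0 : (0 : HomologicalComplex C c) ⟶ S.X₂) (𝟙 S.X₂) zero_comp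
  have hT : T.ShortExact :=
    { exact := (T.exact_iff_mono rfl).2 (inferInstanceAs (Mono (𝟙 S.X₂)))
      mono_f := ⟨fun _ _ _ => (isZero_zero _).eq_of_tgt _ _⟩
      epi_g := inferInstanceAs (Epi (𝟙 S.X₂)) }
  let φ : T ⟶ S :=
    { τ₁ := 0
      τ₂ := 𝟙 S.X₂
      τ₃ := S.g
      comm₁₂ := (isZero_zero _).eq_of_src _ _
      comm₂₃ := rfl }
  have h1 : QuasiIso φ.τ₁ := by
    rw [quasiIso_iff]
    intro i
    rw [quasiIsoAt_iff_isIso_homologyMap]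
    have hi : IsZero ((0 : HomologicalComplex C c).homology i) :=
      (HomologicalComplex.homologyFunctor C c i).map_isZero (isZero_zero _)
    exact ⟨0, hi.eq_of_src _ _, (h i).isZero_homology.eq_of_src _ _⟩
  have h2 : QuasiIso φ.τ₂ := inferInstanceAs (QuasiIso (𝟙 S.X₂))
  exact HomologicalComplex.HomologySequence.quasiIso_τ₃ φ hT hS h1 h2

/-- A simplicial object with projective terms augmented over `B`, such that the augmentation is a
quasi-isomorphism, gives a projective resolution of `B`. -/
def mooreResolution {V : SimplicialObject C} {B : C} (p : V ⟶ (SimplicialObject.const C).obj B)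
    (hp : QuasiIso ((alternatingFaceMapComplex C).map p))
    (hV : ∀ n, Projective (V _⦋n⦌)) : ProjectiveResolution B :=
  let e : (alternatingFaceMapComplex C).obj ((SimplicialObject.const C).obj B) ⟶
      (ChainComplex.single₀ C).obj B :=
    (SimplicialObject.Augmented.ExtraDegeneracy.const B).homotopyEquiv.hom
  have he : QuasiIso e := HomotopyEquiv.quasiIso_hom _
  let q : (normalizedMooreComplex C).obj V ⟶ (alternatingFaceMapComplex C).obj V :=
    (DoldKan.homotopyEquivNormalizedMooreComplexAlternatingFaceMapComplex (Y := V)).hom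
  have hq : QuasiIso q := HomotopyEquiv.quasiIso_hom _
  { complex := (normalizedMooreComplex C).obj V
    projective := fun n => by
      let r := DoldKan.splitMonoInclusionOfMooreComplexMap V
      have := hV n
      exact Retract.projective (Y := V _⦋n⦌)
        { i := (inclusionOfMooreComplexMap V).f n
          r := r.retraction.f n
          retract := HomologicalComplex.congr_hom r.id n }
    π := q ≫ (alternatingFaceMapComplex C).map p ≫ e
    quasiIso := quasiIso_comp _ _ }

/-- The Dold–Puppe derived functors, computed with any simplicial resolution. -/
theorem nonempty_homology_iso_of_simplicialResolution {D : Type*} [Category* D] [Abelian D]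
    [EnoughProjectives C] {V : SimplicialObject C} {B : C}
    (p : V ⟶ (SimplicialObject.const C).obj B)
    (hp : QuasiIso ((alternatingFaceMapComplex C).map p))
    (hV : ∀ n, Projective (V _⦋n⦌)) (Ψ : C ⥤ D) (P : ProjectiveResolution B) (i : ℕ) :
    Nonempty (((alternatingFaceMapComplex D).obj (((SimplicialObject.whiskering C D).obj Ψ).obj
        (Abelian.DoldKan.Γ.obj P.complex))).homology i ≅
      ((alternatingFaceMapComplex D).obj
        (((SimplicialObject.whiskering C D).obj Ψ).obj V)).homology i) := by
  have e : (normalizedMooreComplex C).obj (Abelian.DoldKan.Γ.obj P.complex) ≅ P.complex :=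
    (Abelian.DoldKan.equivalence (A := C)).counitIso.app P.complex
  exact nonempty_homology_whiskering_iso Ψ
    ((HomotopyEquiv.ofIso e).trans (P.homotopyEquiv (mooreResolution p hp hV))) i

end Resolution

end RelationLimits

end

noncomputable section

namespace RelationLimits

open AlgebraicTopology Simplicial Opposite

/-! ### The connecting map to `Ext¹(-, K)` -/

section ExtSequence

variable {K : Type u} [CommRing K]

/-- The connecting map `Hom(S.X₁, K) ⟶ Ext¹(S.X₃, K)` of a short exact sequence `S`. -/
def toDiamond {S : ShortComplex (ModuleCat.{u} K)} (hS : S.ShortExact) :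
    Module.Dual K S.X₁ →ₗ[K] diamond S.X₃ :=
  (hS.extClass.precompOfLinear K (ModuleCat.of K K) (add_zero 1)).comp
    ((Abelian.Ext.linearEquiv₀ (R := K)).symm.toLinearMap.comp
      (ModuleCat.homLinearEquiv (S := K) (M := S.X₁)
        (N := ModuleCat.of K K)).symm.toLinearMap)

lemma toDiamond_apply {S : ShortComplex (ModuleCat.{u} K)} (hS : S.ShortExact)
    (z : Module.Dual K S.X₁) : toDiamond hS z =
      hS.extClass.comp (Abelian.Ext.mk₀ (ModuleCat.ofHom z : S.X₁ ⟶ ModuleCat.of K K))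
        (add_zero 1) := rfl

lemma toDiamond_surjective {S : ShortComplex (ModuleCat.{u} K)} (hS : S.ShortExact)
    [Projective S.X₂] : Function.Surjective (toDiamond hS) := by
  intro x
  obtain ⟨y, hy⟩ := Abelian.Ext.contravariant_sequence_exact₃ hS (ModuleCat.of K K) x
    (Abelian.Ext.eq_zero_of_projective _) (add_zero 1)
  obtain ⟨f, rfl⟩ := (Abelian.Ext.mk₀_bijective _ _).2 y
  exact ⟨f.hom, hy⟩

lemma toDiamond_eq_zero_iff {S : ShortComplex (ModuleCat.{u} K)} (hS : S.ShortExact)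
    (z : Module.Dual K S.X₁) :
    toDiamond hS z = 0 ↔ ∃ w : Module.Dual K S.X₂, S.f.hom.dualMap w = z := by
  constructor
  · intro h
    obtain ⟨y, hy⟩ := Abelian.Ext.contravariant_sequence_exact₁ hS (ModuleCat.of K K)
      (Abelian.Ext.mk₀ (ModuleCat.ofHom z : S.X₁ ⟶ ModuleCat.of K K)) (add_zero 1) h
    obtain ⟨f, rfl⟩ := (Abelian.Ext.mk₀_bijective _ _).2 y
    rw [Abelian.Ext.mk₀_comp_mk₀] at hy
    have := (Abelian.Ext.mk₀_bijective _ _).1 hy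
    exact ⟨f.hom, congrArg ModuleCat.Hom.hom this⟩
  · rintro ⟨w, rfl⟩
    have : (ModuleCat.ofHom (S.f.hom.dualMap w) : S.X₁ ⟶ ModuleCat.of K K) =
      S.f ≫ (ModuleCat.ofHom w : S.X₂ ⟶ ModuleCat.of K K) := rfl
    rw [toDiamond_apply, this, ← Abelian.Ext.mk₀_comp_mk₀, hS.extClass_comp_assoc]
    rfl

lemma toDiamond_naturality {S T : ShortComplex (ModuleCat.{u} K)} (hS : S.ShortExact)
    (hT : T.ShortExact) (φ : S ⟶ T) (z : Module.Dual K T.X₁) :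
    toDiamond hS (φ.τ₁.hom.dualMap z) =
      (Abelian.Ext.mk₀ φ.τ₃).comp (toDiamond hT z) (zero_add 1) := by
  have : (ModuleCat.ofHom (φ.τ₁.hom.dualMap z) : S.X₁ ⟶ ModuleCat.of K K) =
      φ.τ₁ ≫ (ModuleCat.ofHom z : T.X₁ ⟶ ModuleCat.of K K) := rfl
  rw [toDiamond_apply, toDiamond_apply, this, ← Abelian.Ext.mk₀_comp_mk₀,
    ← Abelian.Ext.comp_assoc_of_second_deg_zero, ShortComplex.ShortExact.extClass_naturality hS hT φ,
    Abelian.Ext.comp_assoc_of_third_deg_zero]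

end ExtSequence

end RelationLimits

end

noncomputable section

namespace RelationLimits

open AlgebraicTopology Simplicial Opposite

/-! ### The cosimplicial presentation of powers -/

section Powers

variable {K : Type u} [CommRing K] (F : Type u) [AddCommGroup F] [Module K F]

variable (K) in
/-- The cosimplicial module of the finite powers of a module. -/
def powers : SimplexCategory ⥤ ModuleCat.{u} K where
  obj n := ModuleCat.of K (Fin (n.len + 1) →₀ F)
  map f := ModuleCat.ofHom (Finsupp.lmapDomain F K f.toOrderHom)
  map_id _ := ModuleCat.hom_ext (Finsupp.lmapDomain_id F K)
  map_comp f g := ModuleCat.hom_ext (Finsupp.lmapDomain_comp F K f.toOrderHom g.toOrderHom)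

variable {F} {A : ModuleCat.{u} K} (p : F →ₗ[K] A)

/-- The map from a power of `F` to `A` which is `p` on each summand. -/
def powersTo (n : SimplexCategory) : (Fin (n.len + 1) →₀ F) →ₗ[K] A :=
  Finsupp.lsum K fun _ => p

lemma powersTo_single (n : SimplexCategory) (k : Fin (n.len + 1)) (x : F) :
    powersTo p n (Finsupp.single k x) = p x := by
  simp [powersTo]

lemma powersTo_comp_map {m n : SimplexCategory} (f : m ⟶ n) :
    powersTo p n ∘ₗ ((powers K F).map f).hom = powersTo p m := by
  refine Finsupp.lhom_ext fun k x => ?_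
  rw [powersTo_single]
  change powersTo p n (Finsupp.mapDomain f.toOrderHom (Finsupp.single k x)) = p x
  rw [Finsupp.mapDomain_single, powersTo_single]

lemma powersTo_surjective (hp : Function.Surjective p) (n : SimplexCategory) :
    Function.Surjective (powersTo p n) := fun a => by
  obtain ⟨x, rfl⟩ := hp a
  exact ⟨Finsupp.single 0 x, powersTo_single p n 0 x⟩

variable [Module.Free K F] (hp : Function.Surjective p)

/-- The cosimplicial presentation whose terms are the powers of a presentation `p`. -/
def presPowers : SimplexCategory ⥤ Pres A where
  obj n :=
    { obj := Over.mk (Y := (powers K F).obj n) (ModuleCat.ofHom (powersTo p n))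
      property := ⟨inferInstanceAs (Module.Free K (Fin (n.len + 1) →₀ F)),
        powersTo_surjective p hp n⟩ }
  map f := ObjectProperty.homMk (Over.homMk ((powers K F).map f)
    (ModuleCat.hom_ext (powersTo_comp_map p f)))
  map_id n := by
    ext : 2
    exact (powers K F).map_id n
  map_comp f g := by
    ext : 2
    exact (powers K F).map_comp f g

/-- A free source lifts along any surjection onto `A`, which gives weak initiality; a map over `A`
out of a direct sum is a family of maps over `A`. -/
lemma isCopowerSystem_presPowers : IsCopowerSystem (presPowers p hp) where
  nonempty j := by
    have := j.property.1
    obtain ⟨g, hg⟩ := Module.projective_lifting_property j.obj.hom.hom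
      (powersTo p ⦋0⦌) j.property.2
    exact ⟨ObjectProperty.homMk (Over.homMk (ModuleCat.ofHom g) (ModuleCat.hom_ext hg))⟩
  bijective n j := by
    constructor
    · intro f g h
      ext : 3
      refine Finsupp.lhom_ext fun k x => ?_
      have h1 : ∀ m : (presPowers p hp).obj n ⟶ j,
          ((presPowers p hp).map (SimplexCategory.const ⦋0⦌ n k) ≫ m).hom.left.hom
            (Finsupp.single 0 x) = m.hom.left.hom (Finsupp.single k x) := fun m =>
        congrArg m.hom.left.hom (Finsupp.mapDomain_single (f := fun _ : Fin 1 => k))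
      have h2 := congrArg (fun m : (presPowers p hp).obj ⦋0⦌ ⟶ j =>
        m.hom.left.hom (Finsupp.single 0 x)) (congrFun h k)
      exact (h1 f).symm.trans (h2.trans (h1 g))
    · intro g
      let φ : (Fin (n.len + 1) →₀ F) →ₗ[K] j.obj.left :=
        Finsupp.lsum K fun k => (g k).hom.left.hom ∘ₗ Finsupp.lsingle (0 : Fin 1)
      have hφ (k : Fin (n.len + 1)) (x : F) :
          φ (Finsupp.single k x) = (g k).hom.left.hom (Finsupp.single (0 : Fin 1) x) := by
        simp only [φ, Finsupp.lsum_single]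
        rfl
      refine ⟨ObjectProperty.homMk (Over.homMk (ModuleCat.ofHom φ) (ModuleCat.hom_ext ?_)), ?_⟩
      · refine Finsupp.lhom_ext fun k x => ?_
        refine Eq.trans ?_ (powersTo_single p n k x).symm
        refine (congrArg j.obj.hom.hom (hφ k x)).trans ?_
        exact (congrArg (fun m => m.hom (Finsupp.single (0 : Fin 1) x)) (Over.w (g k).hom)).trans
          (powersTo_single p ⦋0⦌ 0 x)
      · funext k
        ext : 3
        refine Finsupp.lhom_ext fun i x => ?_
        obtain rfl : i = 0 := Subsingleton.elim (α := Fin 1) _ _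
        exact (congrArg φ (Finsupp.mapDomain_single (f := fun _ : Fin 1 => k))).trans (hφ k x)

end Powers

end RelationLimits

end

noncomputable section

namespace RelationLimits

open AlgebraicTopology Simplicial Opposite ZeroObject

/-! ### Duals of relation modules resolve `Ext¹(A, K)` -/

section DualRelations

variable {K : Type u} [CommRing K] (F : Type u) [AddCommGroup F] [Module K F]

variable (K) in
/-- The simplicial module of the duals of the powers of `F`. -/
def dualPowers : SimplicialObject (ModuleCat.{u} K) := (powers K F).op ⋙ dualFunctor K

variable (K) in
/-- The map which leaves out the first coordinate. -/
def powersTail (n : ℕ) : (Fin (n + 2) →₀ F) →ₗ[K] (Fin (n + 1) →₀ F) :=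
  Finsupp.lsum K (Fin.cons (α := fun _ => F →ₗ[K] (Fin (n + 1) →₀ F)) 0
    fun k => Finsupp.lsingle k)

lemma powersTail_single_zero (n : ℕ) (x : F) :
    powersTail K F n (Finsupp.single 0 x) = 0 := by
  simp [powersTail]

lemma powersTail_single_succ (n : ℕ) (k : Fin (n + 1)) (x : F) :
    powersTail K F n (Finsupp.single k.succ x) = Finsupp.single k x := by
  simp [powersTail]

lemma powers_map_single {m n : SimplexCategory} (f : m ⟶ n) (k : Fin (m.len + 1)) (x : F) :
    ((powers K F).map f).hom (Finsupp.single k x) = Finsupp.single (f.toOrderHom k) x :=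
  Finsupp.mapDomain_single

/-- This and the next two lemmas are, before dualizing, the identities of an extra degeneracy for
the duals of the powers augmented over zero. -/
lemma powersTail_comp_map_δ_zero (n : ℕ) :
    powersTail K F n ∘ₗ ((powers K F).map (SimplexCategory.δ (n := n) 0)).hom =
      LinearMap.id := by
  refine Finsupp.lhom_ext fun k x => ?_
  exact (congrArg (powersTail K F n) (powers_map_single F _ k x)).trans
    (powersTail_single_succ F n k x)

lemma powersTail_comp_map_δ_one :
    powersTail K F 0 ∘ₗ ((powers K F).map (SimplexCategory.δ (n := 0) 1)).hom = 0 := by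
  refine Finsupp.lhom_ext fun k x => ?_
  obtain rfl : k = 0 := Subsingleton.elim (α := Fin 1) _ _
  exact (congrArg (powersTail K F 0) (powers_map_single F _ _ x)).trans
    (powersTail_single_zero F 0 x)

lemma powersTail_comp_map_succ {m n : ℕ} (f : ⦋m⦌ ⟶ ⦋n⦌) (g : ⦋m + 1⦌ ⟶ ⦋n + 1⦌)
    (h0 : g.toOrderHom 0 = 0)
    (h : ∀ k : Fin (m + 1), g.toOrderHom k.succ = (f.toOrderHom k).succ) :
    powersTail K F n ∘ₗ ((powers K F).map g).hom =
      ((powers K F).map f).hom ∘ₗ powersTail K F m := by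
  refine Finsupp.lhom_ext fun k x => ?_
  refine (congrArg (powersTail K F n) (powers_map_single F g k x)).trans
    (Eq.trans ?_ (LinearMap.comp_apply _ _ _).symm)
  induction k using Fin.cases with
  | zero =>
    refine (congrArg (fun j => powersTail K F n (Finsupp.single j x)) h0).trans ?_
    exact (powersTail_single_zero F n x).trans ((congrArg ((powers K F).map f).hom
      (powersTail_single_zero F m x)).trans (map_zero _)).symm
  | succ k =>
    refine (congrArg (fun j => powersTail K F n (Finsupp.single j x)) (h k)).trans ?_
    exact (powersTail_single_succ F n _ x).trans ((congrArg ((powers K F).map f).hom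
      (powersTail_single_succ F m k x)).trans (powers_map_single F f k x)).symm

/-- The map of simplicial modules from the duals of the powers of `F` to zero. -/
def augmentedDualPowers : SimplicialObject.Augmented (ModuleCat.{u} K) where
  left := dualPowers K F
  right := 0
  hom := 0

/-- The duals of the powers of `F` are contractible. -/
def dualPowersExtraDegeneracy : (augmentedDualPowers (K := K) F).ExtraDegeneracy where
  s' := 0
  s n := ModuleCat.ofHom (powersTail K F n).dualMap
  s'_comp_ε := (isZero_zero _).eq_of_src _ _
  s₀_comp_δ₁ := by
    refine ModuleCat.hom_ext (LinearMap.ext fun z => ?_)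
    refine Eq.trans (congrArg (fun φ => z ∘ₗ φ) (powersTail_comp_map_δ_one F)) ?_
    exact LinearMap.comp_zero z
  s_comp_δ₀ n := by
    refine ModuleCat.hom_ext (LinearMap.ext fun z => ?_)
    exact congrArg (fun φ => z ∘ₗ φ) (powersTail_comp_map_δ_zero F n)
  s_comp_δ n i := by
    refine ModuleCat.hom_ext (LinearMap.ext fun z => ?_)
    exact congrArg (fun φ => z ∘ₗ φ) (powersTail_comp_map_succ F (SimplexCategory.δ i)
      (SimplexCategory.δ i.succ) rfl fun k => Fin.succ_succAbove_succ i k)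
  s_comp_σ n i := by
    refine ModuleCat.hom_ext (LinearMap.ext fun z => ?_)
    exact congrArg (fun φ => z ∘ₗ φ) (powersTail_comp_map_succ F (SimplexCategory.σ i)
      (SimplexCategory.σ i.succ) rfl fun k => Fin.succ_predAbove_succ i k)

lemma dualPowers_acyclic : ((alternatingFaceMapComplex _).obj (dualPowers K F)).Acyclic := fun i => by
  rw [HomologicalComplex.exactAt_iff_isZero_homology]
  exact ((HomologicalComplex.homologyFunctor _ _ i).map_isZero
    ((ChainComplex.single₀ _).map_isZero (isZero_zero _))).of_iso
    ((dualPowersExtraDegeneracy (K := K) F).homotopyEquiv.toHomologyIso i)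

variable {F} {A : ModuleCat.{u} K} (p : F →ₗ[K] A) (hp : Function.Surjective p)

include hp in
lemma shortExact_powers (n : SimplexCategory) : (powersTo p n).shortComplexKer.ShortExact :=
  LinearMap.shortExact_shortComplexKer (powersTo_surjective p hp n)

/-- This amounts to `Hom(A, K) = 0`: each `m` has a multiple by a nonzero scalar which is a
relation, and `K` has no zero divisors. -/
lemma restrictDual_injective [IsDomain K] (hA : Module.IsTorsion K A) (n : SimplexCategory) :
    Function.Injective (LinearMap.ker (powersTo p n)).subtype.dualMap := by
  rw [injective_iff_map_eq_zero]
  intro w hw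
  refine LinearMap.ext fun m => ?_
  obtain ⟨r, hr⟩ := @hA (powersTo p n m)
  have hm : (r : K) • m ∈ LinearMap.ker (powersTo p n) := by
    rw [LinearMap.mem_ker, map_smul]
    exact hr
  have h : w ((r : K) • m) = 0 := congrArg (fun φ => φ ⟨_, hm⟩) hw
  rw [map_smul, smul_eq_mul, mul_eq_zero] at h
  exact h.resolve_left (nonZeroDivisors.coe_ne_zero r)

variable [Module.Free K F]

/-- The simplicial module of the duals of the relation modules of the powers of a
presentation. -/
def dualRelations : SimplicialObject (ModuleCat.{u} K) :=
  (presPowers p hp ⋙ relationFunctor A).op ⋙ dualFunctor K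

/-- Restriction of linear forms to the relation modules. -/
def restrictDual : dualPowers K F ⟶ dualRelations p hp where
  app n := ModuleCat.ofHom (LinearMap.ker (powersTo p n.unop)).subtype.dualMap
  naturality _ _ _ := rfl

/-- The map of short exact sequences induced by a map between powers of a presentation. -/
def shortComplexKerMap {m n : SimplexCategory} (f : m ⟶ n) :
    (powersTo p m).shortComplexKer ⟶ (powersTo p n).shortComplexKer where
  τ₁ := (presPowers p hp ⋙ relationFunctor A).map f
  τ₂ := (powers K F).map f
  τ₃ := 𝟙 _
  comm₁₂ := rfl
  comm₂₃ := ModuleCat.hom_ext (powersTo_comp_map p f)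

/-- The connecting maps from the duals of the relation modules to `Ext¹(A, K)`. -/
def dualRelationsToDiamond :
    dualRelations p hp ⟶ (SimplicialObject.const _).obj (diamond A) where
  app n := ModuleCat.ofHom (toDiamond (shortExact_powers p hp n.unop))
  naturality m n f := by
    ext z
    refine (toDiamond_naturality _ (shortExact_powers p hp m.unop)
      (shortComplexKerMap p hp f.unop) z).trans ?_
    exact Abelian.Ext.mk₀_id_comp _

variable [IsDomain K]

/-- The short exact sequence of simplicial modules which relates the duals of the relation
modules to `Ext¹(A, K)`. -/
abbrev dualSequence : ShortComplex (SimplicialObject (ModuleCat.{u} K)) where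
  X₁ := dualPowers K F
  X₂ := dualRelations p hp
  X₃ := (SimplicialObject.const _).obj (diamond A)
  f := restrictDual p hp
  g := dualRelationsToDiamond p hp
  zero := by
    ext n w
    exact (toDiamond_eq_zero_iff (shortExact_powers p hp n.unop) _).2 ⟨w, rfl⟩

/-- The kernel of the map is degreewise the dual of a power of `F`, and these duals form an acyclic
complex. -/
lemma quasiIso_dualRelationsToDiamond (hA : Module.IsTorsion K A) :
    QuasiIso ((alternatingFaceMapComplex _).map (dualRelationsToDiamond p hp)) := by
  have hS : ((dualSequence p hp).map (alternatingFaceMapComplex _)).ShortExact := by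
    refine HomologicalComplex.shortExact_of_degreewise_shortExact _ fun n => ?_
    have : Projective (powersTo p ⦋n⦌).shortComplexKer.X₂ :=
      ModuleCat.projective_of_free (Module.Free.chooseBasis K (Fin (n + 1) →₀ F))
    refine ModuleCat.shortComplex_shortExact _ ?_ (restrictDual_injective p hA ⦋n⦌)
      (toDiamond_surjective (shortExact_powers p hp ⦋n⦌))
    exact fun z => (toDiamond_eq_zero_iff (shortExact_powers p hp ⦋n⦌) z)
  exact quasiIso_g_of_acyclic hS (dualPowers_acyclic F)

end DualRelations

end RelationLimits

end

noncomputable section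

namespace RelationLimits

/-! ### Cohomology of a dual complex and evaluation on homology -/

section LinearAlgebra

variable {K : Type u} [CommRing K]

/-- A map which has the same kernel as a surjection factors through it by an injection. -/
lemma exists_injective_comp_eq {M N P : Type*} [AddCommGroup M] [AddCommGroup N] [AddCommGroup P]
    [Module K M] [Module K N] [Module K P] (s : M →ₗ[K] N) (hs : Function.Surjective s)
    (ψ : M →ₗ[K] P) (h : ∀ x, s x = 0 ↔ ψ x = 0) :
    ∃ f : N →ₗ[K] P, Function.Injective f ∧ ∀ x, f (s x) = ψ x := by
  have hker : LinearMap.ker s ≤ LinearMap.ker ψ := fun x hx => (h x).1 hx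
  let f : N →ₗ[K] P := (LinearMap.ker s).liftQ ψ hker ∘ₗ
    (s.quotKerEquivOfSurjective hs).symm.toLinearMap
  have hf : ∀ x, f (s x) = ψ x := fun x => by
    have : (s.quotKerEquivOfSurjective hs).symm (s x) = (LinearMap.ker s).mkQ x := by
      rw [LinearEquiv.symm_apply_eq]
      rfl
    simp only [f, LinearMap.comp_apply, LinearEquiv.coe_coe, this]
    rfl
  refine ⟨f, ?_, hf⟩
  rw [injective_iff_map_eq_zero]
  intro y hy
  obtain ⟨x, rfl⟩ := hs y
  rw [hf] at hy
  exact (h x).2 hy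

/-- The kernel of a map with projective range is a retract. -/
lemma exists_retraction_ker {Q R : Type*} [AddCommGroup Q] [AddCommGroup R] [Module K Q]
    [Module K R] (b : Q →ₗ[K] R) [Module.Projective K (LinearMap.range b)] :
    ∃ ρ : Q →ₗ[K] LinearMap.ker b, ∀ x : LinearMap.ker b, ρ x = x := by
  obtain ⟨s, hs⟩ := Module.projective_lifting_property b.rangeRestrict LinearMap.id
    b.surjective_rangeRestrict
  have hs' (y : LinearMap.range b) : b (s y) = y :=
    congrArg Subtype.val (LinearMap.congr_fun hs y)
  let r : Q →ₗ[K] Q := LinearMap.id - s ∘ₗ b.rangeRestrict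
  have hr (x : Q) : r x ∈ LinearMap.ker b := by
    change b (x - s (b.rangeRestrict x)) = 0
    rw [map_sub, hs']
    exact sub_self _
  refine ⟨r.codRestrict _ hr, fun x => ?_⟩
  have : b.rangeRestrict x = 0 := Subtype.ext x.2
  ext
  simp [r, this]

section HomologyQuotient

variable {P Q R : Type v} [AddCommGroup P] [AddCommGroup Q] [AddCommGroup R] [Module K P]
  [Module K Q] [Module K R] (a : P →ₗ[K] Q) (b : Q →ₗ[K] R) (hab : b ∘ₗ a = 0)

/-- The short complex of modules `P ⟶ Q ⟶ R`. -/
abbrev linearShortComplex : ShortComplex (ModuleCat.{v} K) :=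
  ShortComplex.mk (ModuleCat.ofHom a) (ModuleCat.ofHom b) (ModuleCat.hom_ext hab)

/-- The homology of `P ⟶ Q ⟶ R`, as a quotient of the kernel. -/
abbrev homologyQuotient : Type v :=
  LinearMap.ker b ⧸ LinearMap.range (linearShortComplex a b hab).moduleCatToCycles

variable {a b} {P' Q' R' : Type w} [AddCommGroup P'] [AddCommGroup Q'] [AddCommGroup R']
  [Module K P'] [Module K Q'] [Module K R'] {a' : P' →ₗ[K] Q'} {b' : Q' →ₗ[K] R'}
  (hab' : b' ∘ₗ a' = 0)

/-- Isomorphic complexes have isomorphic homology. -/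
def homologyQuotientEquiv (e₁ : P ≃ₗ[K] P') (e₂ : Q ≃ₗ[K] Q') (e₃ : R ≃ₗ[K] R')
    (ha : ∀ x, e₂ (a x) = a' (e₁ x)) (hb : ∀ x, e₃ (b x) = b' (e₂ x)) :
    homologyQuotient a b hab ≃ₗ[K] homologyQuotient a' b' hab' :=
  have hker : (LinearMap.ker b).map (e₂ : Q →ₗ[K] Q') = LinearMap.ker b' := by
    ext y
    obtain ⟨x, rfl⟩ := e₂.surjective y
    simp only [Submodule.mem_map, LinearMap.mem_ker, LinearEquiv.coe_coe, ← hb,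
      EmbeddingLike.map_eq_zero_iff, EmbeddingLike.apply_eq_iff_eq, exists_eq_right]
  Submodule.Quotient.equiv _ _ (e₂.ofSubmodules _ _ hker) (by
    ext y
    constructor
    · rintro ⟨_, ⟨x, rfl⟩, rfl⟩
      exact ⟨e₁ x, Subtype.ext (ha x).symm⟩
    · rintro ⟨x, rfl⟩
      refine ⟨_, ⟨e₁.symm x, rfl⟩, Subtype.ext ?_⟩
      exact (ha _).trans (congrArg a' (e₁.apply_symm_apply x)))

end HomologyQuotient

variable {P Q R : Type u} [AddCommGroup P] [AddCommGroup Q] [AddCommGroup R] [Module K P]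
  [Module K Q] [Module K R] (a : P →ₗ[K] Q) (b : Q →ₗ[K] R) (hab : b ∘ₗ a = 0)

include hab in
lemma dualMap_comp_dualMap_eq_zero : a.dualMap ∘ₗ b.dualMap = 0 := by
  refine LinearMap.ext fun z => ?_
  exact (congrArg (fun φ => z ∘ₗ φ) hab).trans (LinearMap.comp_zero z)

/-- The cohomology of the dual complex. -/
abbrev cohomologyQuotient : Type u :=
  homologyQuotient b.dualMap a.dualMap (dualMap_comp_dualMap_eq_zero a b hab)

/-- The linear form on homology which is given by a cocycle. -/
def cocycleToDual : LinearMap.ker a.dualMap →ₗ[K] Module.Dual K (homologyQuotient a b hab) where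
  toFun z := Submodule.liftQ _ (z.1 ∘ₗ (LinearMap.ker b).subtype) (by
    rintro _ ⟨x, rfl⟩
    exact LinearMap.congr_fun z.2 x)
  map_add' _ _ := Submodule.linearMap_qext _ rfl
  map_smul' _ _ := Submodule.linearMap_qext _ rfl

/-- The evaluation map from cohomology to the dual of homology. -/
def evaluationMap : cohomologyQuotient a b hab →ₗ[K] Module.Dual K (homologyQuotient a b hab) :=
  Submodule.liftQ _ (cocycleToDual a b hab) (by
    rintro _ ⟨w, rfl⟩
    refine Submodule.linearMap_qext _ (LinearMap.ext fun x => ?_)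
    exact (congrArg w x.2).trans (map_zero w))

/-- The cohomology classes given by the linear forms on the range of `b`. -/
def boundaryToCohomology : Module.Dual K (LinearMap.range b) →ₗ[K] cohomologyQuotient a b hab :=
  Submodule.mkQ _ ∘ₗ b.rangeRestrict.dualMap.codRestrict (LinearMap.ker a.dualMap) fun y => by
    refine LinearMap.ext fun x => ?_
    have : b.rangeRestrict (a x) = 0 := Subtype.ext (LinearMap.congr_fun hab x)
    exact (congrArg y this).trans (map_zero y)

lemma boundaryToCohomology_eq_zero_iff (y : Module.Dual K (LinearMap.range b)) :
    boundaryToCohomology a b hab y = 0 ↔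
      ∃ w : Module.Dual K R, (LinearMap.range b).subtype.dualMap w = y := by
  refine (Submodule.Quotient.mk_eq_zero _).trans ⟨?_, ?_⟩
  · rintro ⟨w, hw⟩
    refine ⟨w, LinearMap.ext ?_⟩
    rintro ⟨_, x, rfl⟩
    exact LinearMap.congr_fun (congrArg Subtype.val hw) x
  · rintro ⟨w, rfl⟩
    exact ⟨w, rfl⟩

/-- A retraction onto the cycles extends a form on cycles to a cochain; it stays zero on boundaries.
-/
lemma evaluationMap_surjective [Module.Projective K (LinearMap.range b)] :
    Function.Surjective (evaluationMap a b hab) := by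
  intro χ
  obtain ⟨ρ, hρ⟩ := exists_retraction_ker b
  let z : Module.Dual K Q := χ ∘ₗ Submodule.mkQ _ ∘ₗ ρ
  have hz : z ∈ LinearMap.ker a.dualMap := by
    refine LinearMap.ext fun x => ?_
    have hx : a x ∈ LinearMap.ker b := LinearMap.congr_fun hab x
    have h1 : ρ (a x) = ⟨a x, hx⟩ := hρ ⟨a x, hx⟩
    have h2 : (LinearMap.range (linearShortComplex a b hab).moduleCatToCycles).mkQ
        ⟨a x, hx⟩ = 0 := (Submodule.Quotient.mk_eq_zero _).2 ⟨x, rfl⟩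
    change χ (Submodule.mkQ _ (ρ (a x))) = 0
    rw [h1, h2, map_zero]
  refine ⟨Submodule.Quotient.mk ⟨z, hz⟩, Submodule.linearMap_qext _ (LinearMap.ext fun x => ?_)⟩
  exact congrArg (fun y => χ (Submodule.mkQ _ y)) (hρ x)

/-- A cocycle that vanishes on all cycles factors through the range of `b`. -/
lemma evaluationMap_eq_zero_iff (ζ : cohomologyQuotient a b hab) :
    evaluationMap a b hab ζ = 0 ↔ ∃ y, boundaryToCohomology a b hab y = ζ := by
  constructor
  · obtain ⟨z, rfl⟩ := Submodule.Quotient.mk_surjective _ ζ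
    intro h
    have hz : LinearMap.ker b ≤ LinearMap.ker z.1 := fun x hx =>
      LinearMap.congr_fun h (Submodule.Quotient.mk ⟨x, hx⟩)
    refine ⟨(LinearMap.ker b).liftQ z.1 hz ∘ₗ b.quotKerEquivRange.symm.toLinearMap,
      congrArg Submodule.Quotient.mk (Subtype.ext (LinearMap.ext fun x => ?_))⟩
    exact congrArg ((LinearMap.ker b).liftQ z.1 hz)
      (b.quotKerEquivRange_symm_apply_image x ⟨x, rfl⟩)
  · rintro ⟨y, rfl⟩
    refine Submodule.linearMap_qext _ (LinearMap.ext fun x => ?_)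
    have : b.rangeRestrict x = 0 := Subtype.ext x.2
    exact (congrArg y this).trans (map_zero y)

end LinearAlgebra

/-! ### The universal coefficient sequence -/

section UniversalCoefficients

variable {K : Type u} [CommRing K] {P Q R T : Type u} [AddCommGroup P] [AddCommGroup Q]
  [AddCommGroup R] [AddCommGroup T] [Module K P] [Module K Q] [Module K R] [Module K T]
  (a : P →ₗ[K] Q) (b : Q →ₗ[K] R) (c : R →ₗ[K] T) (hab : b ∘ₗ a = 0) (hbc : c ∘ₗ b = 0)

/-- The inclusion of the boundaries in the cycles. -/
def boundaryInclusion : LinearMap.range b →ₗ[K] LinearMap.ker c :=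
  Submodule.inclusion (LinearMap.range_le_ker_iff.2 hbc)

/-- The map from cycles to homology. -/
def cyclesToHomology : LinearMap.ker c →ₗ[K] homologyQuotient b c hbc :=
  Submodule.mkQ _

lemma cyclesToHomology_eq_zero_iff (x : LinearMap.ker c) :
    cyclesToHomology b c hbc x = 0 ↔ ∃ y, boundaryInclusion b c hbc y = x := by
  refine (Submodule.Quotient.mk_eq_zero _).trans ⟨?_, ?_⟩
  · rintro ⟨y, rfl⟩
    exact ⟨⟨b y, y, rfl⟩, rfl⟩
  · rintro ⟨⟨_, y, rfl⟩, rfl⟩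
    exact ⟨y, rfl⟩

lemma cyclesToHomology_comp_boundaryInclusion :
    cyclesToHomology b c hbc ∘ₗ boundaryInclusion b c hbc = 0 :=
  LinearMap.ext fun y => (cyclesToHomology_eq_zero_iff b c hbc _).2 ⟨y, rfl⟩

/-- The short exact sequence of boundaries, cycles and homology. -/
lemma shortExact_homologyQuotient :
    (linearShortComplex (boundaryInclusion b c hbc) (cyclesToHomology b c hbc)
      (cyclesToHomology_comp_boundaryInclusion b c hbc)).ShortExact :=
  ModuleCat.shortComplex_shortExact _ (cyclesToHomology_eq_zero_iff b c hbc)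
    (Submodule.inclusion_injective (LinearMap.range_le_ker_iff.2 hbc)) (Submodule.mkQ_surjective _)

/-- The left side vanishes if `y` extends to the cycles, the right side if it extends to all of `R`.
These agree because the cycles are a retract of `R`. -/
lemma toDiamond_eq_zero_iff_boundaryToCohomology [Module.Projective K (LinearMap.range c)]
    (y : Module.Dual K (LinearMap.range b)) :
    toDiamond (shortExact_homologyQuotient b c hbc) y = 0 ↔
      boundaryToCohomology a b hab y = 0 := by
  obtain ⟨ρ, hρ⟩ := exists_retraction_ker c
  refine (toDiamond_eq_zero_iff (shortExact_homologyQuotient b c hbc) y).trans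
    (Iff.trans ⟨?_, ?_⟩ (boundaryToCohomology_eq_zero_iff a b hab y).symm)
  · rintro ⟨w, rfl⟩
    refine ⟨w ∘ₗ ρ, LinearMap.ext fun x => ?_⟩
    exact congrArg w (hρ (boundaryInclusion b c hbc x))
  · rintro ⟨w, rfl⟩
    exact ⟨w ∘ₗ (LinearMap.ker c).subtype, rfl⟩

/-- The universal coefficient sequence. -/
theorem exists_universalCoefficients [Module.Projective K (LinearMap.range b)]
    [Module.Projective K (LinearMap.range c)] [Module.Projective K (LinearMap.ker c)] :
    ∃ (f : diamond (ModuleCat.of K (homologyQuotient b c hbc)) →ₗ[K] cohomologyQuotient a b hab)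
      (g : cohomologyQuotient a b hab →ₗ[K] Module.Dual K (homologyQuotient a b hab)),
      Function.Injective f ∧ Function.Exact f g ∧ Function.Surjective g := by
  have : Projective (ModuleCat.of K (LinearMap.ker c)) :=
    (IsProjective.iff_projective _).1 inferInstance
  -- As the cycles are projective, `Ext¹` of homology is a quotient of the dual of the boundaries,
  -- by the same kernel as the image of that dual in cohomology.
  have hsurj := toDiamond_surjective (shortExact_homologyQuotient b c hbc)
  obtain ⟨f, hf, hf'⟩ := exists_injective_comp_eq _ hsurj (boundaryToCohomology a b hab)
    (toDiamond_eq_zero_iff_boundaryToCohomology a b c hab hbc)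
  refine ⟨f, evaluationMap a b hab, hf, fun ζ => ?_, evaluationMap_surjective a b hab⟩
  refine (evaluationMap_eq_zero_iff a b hab ζ).trans ⟨?_, ?_⟩
  · rintro ⟨y, rfl⟩
    exact ⟨_, hf' y⟩
  · rintro ⟨x, rfl⟩
    obtain ⟨y, rfl⟩ := hsurj x
    exact ⟨y, (hf' y).symm⟩

/-- The universal coefficient sequence in degree zero. -/
theorem evaluationMap_bijective_of_eq_zero (hb : b = 0) :
    Function.Bijective (evaluationMap a b hab) := by
  subst hb
  have : Subsingleton (LinearMap.range (0 : Q →ₗ[K] R)) := by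
    rw [LinearMap.range_zero]
    infer_instance
  refine ⟨(injective_iff_map_eq_zero _).2 fun ζ hζ => ?_, evaluationMap_surjective a 0 hab⟩
  obtain ⟨y, rfl⟩ := (evaluationMap_eq_zero_iff a 0 hab ζ).1 hζ
  rw [Subsingleton.elim y 0, map_zero]

end UniversalCoefficients

end RelationLimits

end

noncomputable section

namespace RelationLimits

open AlgebraicTopology Simplicial Opposite

/-! ### Transport along isomorphisms -/

section Transport

variable {K : Type u} [CommRing K]

/-- The homology of a complex of modules, as a quotient of the kernel. -/
def homologyEquivQuotient {ι : Type*} {c : ComplexShape ι}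
    (C : HomologicalComplex (ModuleCat.{v} K) c) (i j k : ι) (hi : c.prev j = i)
    (hk : c.next j = k) (h : (C.d j k).hom ∘ₗ (C.d i j).hom = 0) :
    C.homology j ≃ₗ[K] homologyQuotient (C.d i j).hom (C.d j k).hom h :=
  (ShortComplex.homologyMapIso (C.isoSc' i j k hi hk) ≪≫
    (C.sc' i j k).moduleCatHomologyIso).toLinearEquiv

lemma d_hom_comp_d_hom {ι : Type*} {c : ComplexShape ι}
    (C : HomologicalComplex (ModuleCat.{v} K) c) (i j k : ι) :
    (C.d j k).hom ∘ₗ (C.d i j).hom = 0 :=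
  congrArg ModuleCat.Hom.hom (C.d_comp_d i j k)

/-- An isomorphism of modules induces an isomorphism on `Ext¹(-, K)`. -/
def diamondEquiv {M N : ModuleCat.{u} K} (e : M ≅ N) : diamond N ≃ₗ[K] diamond M :=
  LinearEquiv.ofLinearMap
    ((Abelian.Ext.mk₀ e.hom).precompOfLinear K (ModuleCat.of K K) (zero_add 1))
    ((Abelian.Ext.mk₀ e.inv).precompOfLinear K (ModuleCat.of K K) (zero_add 1))
    (LinearMap.ext fun x => by
      refine (Abelian.Ext.mk₀_comp_mk₀_assoc _ _ _).trans ?_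
      rw [e.hom_inv_id]
      exact Abelian.Ext.mk₀_id_comp _)
    (LinearMap.ext fun x => by
      refine (Abelian.Ext.mk₀_comp_mk₀_assoc _ _ _).trans ?_
      rw [e.inv_hom_id]
      exact Abelian.Ext.mk₀_id_comp _)

lemma subsingleton_diamond (M : ModuleCat.{u} K) [Projective M] : Subsingleton (diamond M) :=
  ⟨fun x y => (Abelian.Ext.eq_zero_of_projective x).trans
    (Abelian.Ext.eq_zero_of_projective y).symm⟩

lemma exists_shortExact_of_equiv {X Y Z X' Y' Z' : Type*} [AddCommGroup X] [AddCommGroup Y]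
    [AddCommGroup Z] [AddCommGroup X'] [AddCommGroup Y'] [AddCommGroup Z'] [Module K X]
    [Module K Y] [Module K Z] [Module K X'] [Module K Y'] [Module K Z'] (eX : X' ≃ₗ[K] X)
    (eY : Y' ≃ₗ[K] Y) (eZ : Z' ≃ₗ[K] Z)
    (h : ∃ (f : X →ₗ[K] Y) (g : Y →ₗ[K] Z),
      Function.Injective f ∧ Function.Exact f g ∧ Function.Surjective g) :
    ∃ (f : X' →ₗ[K] Y') (g : Y' →ₗ[K] Z'),
      Function.Injective f ∧ Function.Exact f g ∧ Function.Surjective g := by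
  obtain ⟨f, g, hf, hfg, hg⟩ := h
  refine ⟨eY.symm ∘ₗ f ∘ₗ eX, eZ.symm ∘ₗ g ∘ₗ eY,
    eY.symm.injective.comp (hf.comp eX.injective), fun y => ?_,
    eZ.symm.surjective.comp (hg.comp eY.surjective)⟩
  refine eZ.symm.map_eq_zero_iff.trans ((hfg (eY y)).trans ⟨?_, ?_⟩)
  · rintro ⟨x, hx⟩
    refine ⟨eX.symm x, ?_⟩
    change eY.symm (f (eX (eX.symm x))) = y
    rw [eX.apply_symm_apply, hx, eY.symm_apply_apply]
  · rintro ⟨x, rfl⟩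
    exact ⟨eX x, (eY.apply_symm_apply _).symm⟩

lemma apply_sum_eq_dualMap_sum {ι : Type*} [Fintype ι] {M N : ModuleCat.{v} K}
    {P Q : ModuleCat.{w} K} (e : M →ₗ[K] Module.Dual K P) (e' : N →ₗ[K] Module.Dual K Q)
    (a : ι → (M ⟶ N)) (b : ι → (Q ⟶ P)) (h : ∀ i x, e' ((a i).hom x) = (b i).hom.dualMap (e x))
    (ε : ι → ℤ) (x : M) :
    e' ((∑ i, ε i • a i).hom x) = (∑ i, ε i • b i).hom.dualMap (e x) := by
  ext y
  simp only [ModuleCat.hom_sum, ModuleCat.hom_zsmul, LinearMap.sum_apply, LinearMap.smul_apply,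
    map_sum, map_zsmul, h, LinearMap.dualMap_apply]

end Transport

/-! ### Biduality for the Kuhn dual -/

section KuhnDual

variable {K : Type u} [CommRing K] (Φ : ModuleCat.{u} K ⥤ ModuleCat.{u} K)

/-- The canonical map from `Φ(M)` to `(Φ^#(M^∨))^∨`. -/
def toDualKuhnDual (M : ModuleCat.{u} K) :
    Φ.obj M →ₗ[K] Module.Dual K ((kuhnDual Φ).obj (ModuleCat.of K (Module.Dual K M))) :=
  Module.Dual.eval K (Φ.obj (ModuleCat.of K (Module.Dual K (Module.Dual K M)))) ∘ₗ
    (Φ.map (ModuleCat.ofHom (Module.Dual.eval K M))).hom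

lemma toDualKuhnDual_naturality {M N : ModuleCat.{u} K} (f : M ⟶ N) (x : Φ.obj M) :
    toDualKuhnDual Φ N ((Φ.map f).hom x) =
      ((kuhnDual Φ).map ((dualFunctor K).map f.op)).hom.dualMap (toDualKuhnDual Φ M x) := by
  have h : f ≫ ModuleCat.ofHom (Module.Dual.eval K N) =
      ModuleCat.ofHom (Module.Dual.eval K M) ≫
        (dualFunctor K).map ((dualFunctor K).map f.op).op := rfl
  have h' := congrArg ModuleCat.Hom.hom
    ((Φ.map_comp _ _).symm.trans ((congrArg Φ.map h).trans (Φ.map_comp _ _)))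
  exact congrArg (Module.Dual.eval K (Φ.obj (ModuleCat.of K (Module.Dual K (Module.Dual K N)))))
    (LinearMap.congr_fun h' x)

/-- Biduality is used twice: for `M`, under `Φ`, and for the finite free module `Φ(M^∨∨)`. -/
lemma toDualKuhnDual_bijective (M : ModuleCat.{u} K) [Module.Finite K M] [Module.Free K M]
    (hΦ : ∀ F : ModuleCat.{u} K, Module.Finite K F → Module.Free K F →
      Module.Finite K (Φ.obj F) ∧ Module.Free K (Φ.obj F)) :
    Function.Bijective (toDualKuhnDual Φ M) := by
  obtain ⟨_, _⟩ := hΦ (ModuleCat.of K (Module.Dual K (Module.Dual K M)))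
    (inferInstanceAs (Module.Finite K (Module.Dual K (Module.Dual K M))))
    (inferInstanceAs (Module.Free K (Module.Dual K (Module.Dual K M))))
  have : IsIso (ModuleCat.ofHom (Module.Dual.eval K M)) :=
    (Module.evalEquiv K M).toModuleIso.isIso_hom
  have h : Function.Bijective (Φ.map (ModuleCat.ofHom (Module.Dual.eval K M))).hom :=
    (ConcreteCategory.isIso_iff_bijective (Φ.map (ModuleCat.ofHom (Module.Dual.eval K M)))).1
      inferInstance
  exact (Module.bijective_dual_eval K
    (Φ.obj (ModuleCat.of K (Module.Dual K (Module.Dual K M))))).comp h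

end KuhnDual

/-! ### The relation complex as a dual complex -/

section Comparison

variable {K : Type u} [CommRing K] {A : ModuleCat.{u} K}
  (Φ : ModuleCat.{u} K ⥤ ModuleCat.{u} K)
  {F : Type u} [AddCommGroup F] [Module K F] [Module.Free K F]
  (p : F →ₗ[K] A) (hp : Function.Surjective p)

/-- The chain complex which computes the derived functors of the Kuhn dual of `Φ`. -/
abbrev kuhnDualComplex : ChainComplex (ModuleCat.{u} K) ℕ :=
  (alternatingFaceMapComplex _).obj
    (((SimplicialObject.whiskering _ _).obj (kuhnDual Φ)).obj (dualRelations p hp))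

/-- The cochain complex which computes the higher limits of `Φ` on relations. -/
abbrev relationComplex : CochainComplex (ModuleCat.{u + 1} K) ℕ :=
  (cobar K (presPowers p hp)).obj
    ((relationFunctor A ⋙ Φ) ⋙ ModuleCat.uliftFunctor.{u + 1, u} K)

lemma kuhnDualComplex_d (n : ℕ) :
    (kuhnDualComplex Φ p hp).d (n + 1) n = ∑ i : Fin (n + 2), (-1 : ℤ) ^ (i : ℕ) •
      (dualRelations p hp ⋙ kuhnDual Φ).map (SimplexCategory.δ i).op :=
  AlternatingFaceMapComplex.obj_d_eq (dualRelations p hp ⋙ kuhnDual Φ) n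

variable [IsDomain K] [IsPrincipalIdealRing K] [Module.Finite K F]
  (hΦ : ∀ F : ModuleCat.{u} K, Module.Finite K F → Module.Free K F →
      Module.Finite K (Φ.obj F) ∧ Module.Free K (Φ.obj F))

/-- The terms of the complex of higher limits are dual to those of the complex of derived
functors. -/
def relationComplexEquiv (n : ℕ) :
    (relationComplex Φ p hp).X n ≃ₗ[K] Module.Dual K ((kuhnDualComplex Φ p hp).X n) :=
  ULift.moduleEquiv.trans (LinearEquiv.ofBijective
    (toDualKuhnDual Φ (ModuleCat.of K (LinearMap.ker (powersTo p ⦋n⦌))))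
    -- The relation module is finite and free, as a submodule of a finite free module over a
    -- principal ideal domain.
    (toDualKuhnDual_bijective Φ _ hΦ))

lemma relationComplexEquiv_map {m n : ℕ} (f : ⦋m⦌ ⟶ ⦋n⦌) (x : (relationComplex Φ p hp).X m) :
    relationComplexEquiv Φ p hp hΦ n ((((relationFunctor A ⋙ Φ) ⋙
      ModuleCat.uliftFunctor.{u + 1, u} K).map ((presPowers p hp).map f)).hom x) =
    (((dualRelations p hp ⋙ kuhnDual Φ).map f.op).hom.dualMap
      (relationComplexEquiv Φ p hp hΦ m x)) :=
  toDualKuhnDual_naturality Φ ((relationFunctor A).map ((presPowers p hp).map f)) x.down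

lemma relationComplexEquiv_d (n : ℕ) (x : (relationComplex Φ p hp).X n) :
    relationComplexEquiv Φ p hp hΦ (n + 1) (((relationComplex Φ p hp).d n (n + 1)).hom x) =
      ((kuhnDualComplex Φ p hp).d (n + 1) n).hom.dualMap (relationComplexEquiv Φ p hp hΦ n x) := by
  refine Eq.trans (congrArg (fun φ => relationComplexEquiv Φ p hp hΦ (n + 1) (φ.hom x))
    (cobar_d (presPowers p hp) ((relationFunctor A ⋙ Φ) ⋙
      ModuleCat.uliftFunctor.{u + 1, u} K) n)) (Eq.trans ?_
    (congrArg (fun φ => φ.hom.dualMap (relationComplexEquiv Φ p hp hΦ n x))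
      (kuhnDualComplex_d Φ p hp n)).symm)
  exact apply_sum_eq_dualMap_sum (relationComplexEquiv Φ p hp hΦ n).toLinearMap
    (relationComplexEquiv Φ p hp hΦ (n + 1)).toLinearMap _ _
    (fun _ => relationComplexEquiv_map Φ p hp hΦ _) _ x

include hΦ in
lemma finite_free_kuhnDualComplex (n : ℕ) :
    Module.Finite K ((kuhnDualComplex Φ p hp).X n) ∧
      Module.Free K ((kuhnDualComplex Φ p hp).X n) := by
  let M := ModuleCat.of K (Module.Dual K (Module.Dual K (LinearMap.ker (powersTo p ⦋n⦌))))
  obtain ⟨_, _⟩ := hΦ M (inferInstanceAs (Module.Finite K (Module.Dual K (Module.Dual K _))))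
    (inferInstanceAs (Module.Free K (Module.Dual K (Module.Dual K _))))
  exact ⟨inferInstanceAs (Module.Finite K (Module.Dual K (Φ.obj M))),
    inferInstanceAs (Module.Free K (Module.Dual K (Φ.obj M)))⟩

include hΦ in
lemma exists_universalCoefficients_higherLim (i : ℕ) :
    ∃ (f : diamond ((kuhnDualComplex Φ p hp).homology i) →ₗ[K]
        higherLim (i + 1) (relationFunctor A ⋙ Φ))
      (g : higherLim (i + 1) (relationFunctor A ⋙ Φ) →ₗ[K]
        Module.Dual K ((kuhnDualComplex Φ p hp).homology (i + 1))),
      Function.Injective f ∧ Function.Exact f g ∧ Function.Surjective g := by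
  have hf (n : ℕ) := finite_free_kuhnDualComplex Φ p hp hΦ n
  obtain ⟨_, _⟩ := hf i
  -- For `i = 0` the successor index is `0` itself and the differential is zero, so no case
  -- distinction is needed. Freeness in degrees `i` and `next i` makes the boundaries and cycles in
  -- the universal coefficient sequence projective.
  obtain ⟨_, _⟩ := hf ((ComplexShape.down ℕ).next i)
  obtain ⟨e⟩ := nonempty_rightDerived_lim_iso (isCopowerSystem_presPowers p hp)
    ((relationFunctor A ⋙ Φ) ⋙ ModuleCat.uliftFunctor.{u + 1, u} K) (i + 1)
  let D := kuhnDualComplex Φ p hp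
  let C := relationComplex Φ p hp
  let j := (ComplexShape.down ℕ).next i
  have h1 := d_hom_comp_d_hom D (i + 2) (i + 1) i
  have h2 := d_hom_comp_d_hom D (i + 1) i j
  refine exists_shortExact_of_equiv
    (diamondEquiv (homologyEquivQuotient D (i + 1) i j (by simp) rfl h2).toModuleIso.symm)
    (e.toLinearEquiv.trans ((homologyEquivQuotient C i (i + 1) (i + 2) (by simp) (by simp)
      (d_hom_comp_d_hom C _ _ _)).trans
      (homologyQuotientEquiv _ _ (relationComplexEquiv Φ p hp hΦ i)
        (relationComplexEquiv Φ p hp hΦ (i + 1)) (relationComplexEquiv Φ p hp hΦ (i + 2))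
        (relationComplexEquiv_d Φ p hp hΦ i) (relationComplexEquiv_d Φ p hp hΦ (i + 1)))))
    (homologyEquivQuotient D (i + 2) (i + 1) i (by simp) (by simp) h1).symm.dualMap
    (exists_universalCoefficients (D.d (i + 2) (i + 1)).hom (D.d (i + 1) i).hom (D.d i j).hom
      h1 h2)

include hΦ in
lemma nonempty_higherLim_zero_equiv :
    Nonempty (higherLim 0 (relationFunctor A ⋙ Φ) ≃ₗ[K]
      Module.Dual K ((kuhnDualComplex Φ p hp).homology 0)) := by
  obtain ⟨_, _⟩ := finite_free_kuhnDualComplex Φ p hp hΦ 0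
  obtain ⟨e⟩ := nonempty_rightDerived_lim_iso (isCopowerSystem_presPowers p hp)
    ((relationFunctor A ⋙ Φ) ⋙ ModuleCat.uliftFunctor.{u + 1, u} K) 0
  let D := kuhnDualComplex Φ p hp
  let C := relationComplex Φ p hp
  -- Both complexes end at `0`, where the outer index is again `0` with zero differential; there are
  -- no boundaries below, hence no `Ext` term.
  have h1 := d_hom_comp_d_hom D 1 0 0
  have hD : (D.d 0 0).hom = 0 := congrArg ModuleCat.Hom.hom (D.shape 0 0 (by simp))
  have hC : (C.d 0 0).hom = 0 := congrArg ModuleCat.Hom.hom (C.shape 0 0 (by simp))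
  have h0 (x : C.X 0) : relationComplexEquiv Φ p hp hΦ 0 ((C.d 0 0).hom x) =
      (D.d 0 0).hom.dualMap (relationComplexEquiv Φ p hp hΦ 0 x) := by
    rw [hC, hD]
    exact map_zero _
  exact ⟨e.toLinearEquiv.trans ((homologyEquivQuotient C 0 0 1 (by simp) (by simp)
      (d_hom_comp_d_hom C _ _ _)).trans
      ((homologyQuotientEquiv _ _ (relationComplexEquiv Φ p hp hΦ 0)
        (relationComplexEquiv Φ p hp hΦ 0) (relationComplexEquiv Φ p hp hΦ 1)
        h0 (relationComplexEquiv_d Φ p hp hΦ 0)).trans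
      ((LinearEquiv.ofBijective _ (evaluationMap_bijective_of_eq_zero (D.d 1 0).hom (D.d 0 0).hom
        h1 hD)).trans
      (homologyEquivQuotient D 1 0 0 (by simp) (by simp) h1).dualMap)))⟩

lemma nonempty_homotopyModule_iso (hA : Module.IsTorsion K A) (i : ℕ) :
    Nonempty (doldPuppe (kuhnDual Φ) (diamond A) i ≅ (kuhnDualComplex Φ p hp).homology i) :=
  nonempty_homology_iso_of_simplicialResolution (dualRelationsToDiamond p hp)
    (quasiIso_dualRelationsToDiamond p hp hA)
    (fun n => (IsProjective.iff_projective _).1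
      (inferInstanceAs (Module.Projective K (Module.Dual K (LinearMap.ker (powersTo p ⦋n⦌))))))
    (kuhnDual Φ) (projectiveResolution (diamond A)) i

end Comparison



end RelationLimits

end

/-! ### The short exact sequence -/

theorem mainTheorem9 {K : Type u} [CommRing K] [IsDomain K] [IsPrincipalIdealRing K]
    (A : ModuleCat.{u} K) [Module.Finite K A] (hA : Module.IsTorsion K A)
    (Φ : ModuleCat.{u} K ⥤ ModuleCat.{u} K)
    (hΦ : ∀ F : ModuleCat.{u} K, Module.Finite K F → Module.Free K F →
      Module.Finite K (Φ.obj F) ∧ Module.Free K (Φ.obj F))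
    (i : ℕ) :
    ∃ (f : RelationLimits.diamond (RelationLimits.doldPuppe (RelationLimits.kuhnDual Φ)
          (RelationLimits.diamond A) ((i : ℤ) - 1)) →ₗ[K]
        RelationLimits.higherLim i (RelationLimits.relationFunctor A ⋙ Φ))
      (g : RelationLimits.higherLim i (RelationLimits.relationFunctor A ⋙ Φ) →ₗ[K]
        Module.Dual K (RelationLimits.doldPuppe (RelationLimits.kuhnDual Φ)
          (RelationLimits.diamond A) (i : ℤ))),
      Function.Injective f ∧ Function.Exact f g ∧ Function.Surjective g := by
  obtain ⟨m, q, hq⟩ := Module.Finite.exists_fin' K A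
  let p : (Fin m → K) →ₗ[K] A := q
  have hp : Function.Surjective p := hq
  cases i with
  | zero =>
    obtain ⟨e⟩ := RelationLimits.nonempty_higherLim_zero_equiv Φ p hp hΦ
    obtain ⟨e'⟩ := RelationLimits.nonempty_homotopyModule_iso Φ p hp hA 0
    -- In degree `-1` the derived functor is the zero module, so the left term of the sequence
    -- vanishes.
    have : Projective (RelationLimits.doldPuppe (RelationLimits.kuhnDual Φ)
        (RelationLimits.diamond A) (((0 : ℕ) : ℤ) - 1)) :=
      (IsProjective.iff_projective _).1 (inferInstanceAs (Module.Projective K PUnit.{u + 1}))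
    have hsub := RelationLimits.subsingleton_diamond (RelationLimits.doldPuppe
      (RelationLimits.kuhnDual Φ) (RelationLimits.diamond A) (((0 : ℕ) : ℤ) - 1))
    let g := e.trans e'.toLinearEquiv.dualMap
    refine ⟨0, g.toLinearMap, fun x y _ => hsub.elim x y, fun x => ?_, g.surjective⟩
    refine g.map_eq_zero_iff.trans ⟨fun h => ⟨0, h.symm⟩, ?_⟩
    rintro ⟨_, rfl⟩
    rfl
  | succ i =>
    obtain ⟨e⟩ := RelationLimits.nonempty_homotopyModule_iso Φ p hp hA i
    obtain ⟨e'⟩ := RelationLimits.nonempty_homotopyModule_iso Φ p hp hA (i + 1)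
    have hi : ((i + 1 : ℕ) : ℤ) - 1 = i := by simp
    rw [hi]
    exact RelationLimits.exists_shortExact_of_equiv (RelationLimits.diamondEquiv e.symm)
      (LinearEquiv.refl K _) e'.symm.toLinearEquiv.dualMap
      (RelationLimits.exists_universalCoefficients_higherLim Φ p hp hΦ i)
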